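/- Let $V$ be a (commutative) valuation domain with field of quotients $Q$. An \emph{object} (of the class $\mathcal C_V^*$) is a $V$-module of projective dimension at most $1$. For a $V$-module $M$ and $0\neq a\in M$, let the \emph{height-ideal} $H_M(a)\subseteq Q$ be the union of all submodules $J$ of $Q$ with $V\subseteq J$ for which there is a $V$-homomorphism $\phi_J:J\to M$ with $\phi_J(1)=a$; the \emph{height} of $a$ is the module $h_M(a)=H_M(a)/V$. The height is a \emph{non-limit} height if $H_M(a)$ is itself one of these $J$, and a \emph{limit} height otherwise. Write $\operatorname{gen}N$ for the minimal cardinality of a generating set of a module $N$. A module is \emph{uniserial} if its submodules form a chain, and \emph{standard uniserial} if it is isomorphic to $J/I$ for submodules $I<J$ of $Q$. A limit height $h_M(a)$ is \emph{of standard type} if the module $H_M(a)/V$ is standard uniserial and every uniserial submodule $W$ of $M$ with $a\in W$ and $H_W(a)=H_M(a)$ is standard uniserial (so the height is not that of $a$ in a non-standard uniserial submodule). \textbf{Theorem.} (A) Let $M$ be an object and $0\ne a\in M$. Then the height of $a$ in $M$ is of one of the following kinds: (i) a cyclic height: $h_M(a)$ is a non-limit height and a cyclic module (possibly $0$); (ii)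 a countably generated non-limit height: $h_M(a)$ is a non-limit height with $\operatorname{gen}h_M(a)=\aleph_0$; (iii) a limit height of standard type, with no restriction on the number of generators. In particular, $h_M(a)$ is never a non-limit height with $\operatorname{gen}h_M(a)>\aleph_0$. Moreover, if $M$ is finitely generated, then $h_M(a)$ is not a limit height. (B) All of these heights occur. If $J$ is a submodule of $Q$ containing $V$ with $\operatorname{gen}J\le\aleph_0$, then there are an object $M$ and $0\neq a\in M$ with $H_M(a)=J$ such that $h_M(a)$ is a non-limit height. If $J$ is any submodule of $Q$ containing $V$ that is not cyclic, then there are an object $M$ and $0\neq a\in M$ with $H_M(a)=J$ such that $h_M(a)$ is a limit height of standard type. -/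

import Mathlib

universe u v w

/-- The objects of `C_V^*`: the `V`-modules of projective dimension at most one. -/
def IsObject (V : Type u) [CommRing V] (M : Type u) [AddCommGroup M] [Module V M] : Prop :=
  CategoryTheory.HasProjectiveDimensionLE (ModuleCat.of V M) 1

/-- `gen M`: the minimal cardinality of a generating set of the module `M`. -/
noncomputable def gen (V : Type u) [CommRing V] (M : Type v) [AddCommGroup M] [Module V M] :
    Cardinal.{v} :=
  (⊤ : Submodule V M).spanRank

/-- A uniserial module: its submodules form a chain under inclusion. -/
def IsUniserial (V : Type u) [CommRing V] (M : Type v) [AddCommGroup M] [Module V M] : Prop :=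
  ∀ A B : Submodule V M, A ≤ B ∨ B ≤ A

/-- A standard uniserial module: one isomorphic to `J / I` with `I < J` submodules of the field
of quotients `Q`. -/
def IsStandardUniserial (V : Type u) [CommRing V] (Q : Type w) [Field Q] [Algebra V Q]
    (M : Type v) [AddCommGroup M] [Module V M] : Prop :=
  ∃ I J : Submodule V Q, I < J ∧ Nonempty (M ≃ₗ[V] (J ⧸ I.submoduleOf J))

section Height

variable {V : Type u} [CommRing V] {Q : Type w} [Field Q] [Algebra V Q]
  {M : Type v} [AddCommGroup M] [Module V M]

/-- `J` is a submodule of `Q` containing `V` (equivalently, containing `1`) for which there is a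
homomorphism `φ : J → M` with `φ 1 = a`. -/
def AdmitsMap (J : Submodule V Q) (a : M) : Prop :=
  ∃ (h : (1 : Q) ∈ J) (φ : J →ₗ[V] M), φ ⟨1, h⟩ = a

variable (Q) in
/-- The height-ideal `H_M(a)`: the union of all `J` that admit a map `φ : J → M` with `φ 1 = a`.
It is written as a supremum of submodules; that this is the set-theoretic union over a valuation
domain is `mem_heightIdeal`. -/
def heightIdeal (a : M) : Submodule V Q :=
  sSup {J : Submodule V Q | AdmitsMap J a}

variable (Q) in
/-- The height `h_M(a) = H_M(a) / V`. -/
abbrev Height (a : M) : Type w :=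
  heightIdeal (V := V) Q a ⧸ (1 : Submodule V Q).submoduleOf (heightIdeal (V := V) Q a)

variable (V Q) in
/-- `a` has a non-limit height: `H_M(a)` is itself one of the submodules `J`. -/
def IsNonLimitHeight (a : M) : Prop :=
  AdmitsMap (heightIdeal (V := V) Q a) a

variable (V Q) in
/-- `a` has a limit height: `H_M(a)` is not one of the submodules `J`. -/
def IsLimitHeight (a : M) : Prop :=
  ¬ IsNonLimitHeight V Q a

variable (V Q) in
/-- `a` has a cyclic (non-limit) height; the zero height is included. -/
def IsCyclicHeight (a : M) : Prop :=
  IsNonLimitHeight V Q a ∧ (⊤ : Submodule V (Height (V := V) Q a)).IsPrincipal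

variable (V Q) in
/-- `a` has a countably generated non-limit height, where countably generated means
`gen = ℵ₀` (and so not finitely generated). -/
def IsCountablyGeneratedNonLimitHeight (a : M) : Prop :=
  IsNonLimitHeight V Q a ∧ gen V (Height (V := V) Q a) = Cardinal.aleph0

variable (V Q) in
/-- `a` has an uncountably generated non-limit height. -/
def IsUncountablyGeneratedNonLimitHeight (a : M) : Prop :=
  IsNonLimitHeight V Q a ∧ Cardinal.aleph0 < gen V (Height (V := V) Q a)

variable (V Q) in
/-- `a` has a limit height of standard type: the height is a limit height `(J / V)⁻` with `J / V`
a standard uniserial, and it is not the height of `a` in a non-standard uniserial submodule `W`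
of `M`. -/
def IsStandardLimitHeight (a : M) : Prop :=
  IsLimitHeight V Q a ∧ IsStandardUniserial V Q (Height (V := V) Q a) ∧
    ∀ (W : Submodule V M) (haW : a ∈ W), IsUniserial V W →
      heightIdeal (V := V) Q (⟨a, haW⟩ : W) = heightIdeal (V := V) Q a →
      IsStandardUniserial V Q W

/-- The submodules of the field of quotients of a valuation domain form a chain. -/
theorem submodule_le_total [IsDomain V] [ValuationRing V] [IsFractionRing V Q]
    (A B : Submodule V Q) : A ≤ B ∨ B ≤ A := by
  by_contra! h
  obtain ⟨x, hxA, hxB⟩ := SetLike.not_le_iff_exists.mp h.1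
  obtain ⟨y, hyB, hyA⟩ := SetLike.not_le_iff_exists.mp h.2
  have hx : x ≠ 0 := fun h0 => hxB (h0 ▸ B.zero_mem)
  have hy : y ≠ 0 := fun h0 => hyA (h0 ▸ A.zero_mem)
  rcases ValuationRing.isInteger_or_isInteger V (x / y) with ⟨r, hr⟩ | ⟨r, hr⟩
  · apply hxB
    have : x = r • y := by rw [Algebra.smul_def, hr]; field_simp
    exact this ▸ B.smul_mem r hyB
  · apply hyA
    have : y = r • x := by rw [Algebra.smul_def, hr]; field_simp
    exact this ▸ A.smul_mem r hxA

/-- The height-ideal is the union of the submodules `J` occurring in its definition. -/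
theorem mem_heightIdeal [IsDomain V] [ValuationRing V] [IsFractionRing V Q] (a : M) (q : Q) :
    q ∈ heightIdeal (V := V) Q a ↔ ∃ J : Submodule V Q, AdmitsMap J a ∧ q ∈ J := by
  have hne : {J : Submodule V Q | AdmitsMap J a}.Nonempty := by
    refine ⟨1, Submodule.mem_one.mpr ⟨1, map_one _⟩, ?_⟩
    let e : V ≃ₗ[V] LinearMap.range (Algebra.linearMap V Q) :=
      LinearEquiv.ofInjective (Algebra.linearMap V Q) (IsFractionRing.injective V Q)
    refine ⟨(LinearMap.toSpanSingleton V M a).comp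
      (e.symm.toLinearMap.comp (LinearEquiv.ofEq _ _ Submodule.one_eq_range).toLinearMap), ?_⟩
    have : e.symm (LinearEquiv.ofEq _ _ Submodule.one_eq_range
        (⟨1, Submodule.mem_one.mpr ⟨1, map_one _⟩⟩ : (1 : Submodule V Q))) = 1 := by
      rw [LinearEquiv.symm_apply_eq]
      ext
      exact (map_one (algebraMap V Q)).symm
    simp [this]
  exact Submodule.mem_sSup_of_directed hne
    (fun A hA B hB => (submodule_le_total A B).elim
      (fun h => ⟨B, hB, h, le_rfl⟩) (fun h => ⟨A, hA, le_rfl, h⟩))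

end Height

/-! An object `M` is the cokernel of an injective map `κ` of free modules. For a finite set `X` of
generators, the relations supported on `X` form a finitely generated module, and elimination over
the valuation domain makes the submodule generated by `X` a direct sum of cyclically presented
modules (`exists_cyclic_decomposition`). There annihilators are principal and every nonzero element
has a largest divisor (`exists_largest_divisor`).

Principal annihilators, applied to the quotient of `M` by the submodule of a set of generators
closed under the relations, force a uniserial submodule `W` into a countably generated part of `M`.
Hence `W` is countably generated or lies in a finite part
(`IsUniserial.countably_generated_or_le_map_supported`). In the latter case, if `W` realizes the
height of `a`, it contains `w` with `t w = a` for the largest divisor `t` of `a` in that part, and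
`w` generates `W`. So every `W` realizing the height is countably generated, and therefore standard.

For a non-limit height take `W` to be the image of `φ : H_M(a) → M`. Since `φ 1 = a ≠ 0`, the kernel
of `φ` lies in `V`, so `H_M(a) / V` inherits countable generation; being uniserial, it is cyclic if
finitely generated.

Conversely, a countably generated `J` is itself an object, presented by a telescope. For a
non-cyclic `J`, the modules `V r⁻¹ ≤ J` are glued along `V` only: every `r` with `r⁻¹ ∈ J` divides
the base element, but a single map from all of `J` would write `1` as a sum of two non-units of the
local ring `V`. -/

/-! ### Projective dimension one and free presentations -/

open CategoryTheory in
theorem isObject_of_exact {V : Type u} [CommRing V] {K F M : Type u} [AddCommGroup K] [Module V K]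
    [AddCommGroup F] [Module V F] [AddCommGroup M] [Module V M] [Module.Projective V K]
    [Module.Projective V F] (f : K →ₗ[V] F) (g : F →ₗ[V] M) (hf : Function.Injective f)
    (hg : Function.Surjective g) (h : Function.Exact f g) : IsObject V M := by
  let S : ShortComplex (ModuleCat.{u} V) :=
    ShortComplex.mk (ModuleCat.ofHom f) (ModuleCat.ofHom g) (by
      ext x; exact h.apply_apply_eq_zero x)
  have hS : S.ShortExact :=
    { exact := (ShortComplex.ShortExact.moduleCat_exact_iff_function_exact S).mpr h
      mono_f := (ModuleCat.mono_iff_injective _).mpr hf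
      epi_g := (ModuleCat.epi_iff_surjective _).mpr hg }
  have h2 : Projective S.X₂ := (IsProjective.iff_projective F).mp inferInstance
  have h1 : Projective S.X₁ := (IsProjective.iff_projective K).mp inferInstance
  exact (hS.hasProjectiveDimensionLT_X₃_iff 0 h2).mpr inferInstance

open CategoryTheory in
theorem IsObject.projective_ker {V : Type u} [CommRing V] {F M : Type u}
    [AddCommGroup F] [Module V F] [AddCommGroup M] [Module V M] [Module.Projective V F]
    (hM : IsObject V M) (g : F →ₗ[V] M) (hg : Function.Surjective g) :
    Module.Projective V (LinearMap.ker g) := by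
  let S : ShortComplex (ModuleCat.{u} V) :=
    ShortComplex.mk (ModuleCat.ofHom (LinearMap.ker g).subtype) (ModuleCat.ofHom g) (by
      ext x; exact x.2)
  have hS : S.ShortExact :=
    { exact := (ShortComplex.ShortExact.moduleCat_exact_iff_function_exact S).mpr
        (LinearMap.exact_subtype_ker_map g)
      mono_f := (ModuleCat.mono_iff_injective _).mpr (Submodule.subtype_injective _)
      epi_g := (ModuleCat.epi_iff_surjective _).mpr hg }
  have h2 : Projective S.X₂ := (IsProjective.iff_projective F).mp inferInstance
  have h1 := (hS.hasProjectiveDimensionLT_X₃_iff 0 h2).mp hM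
  exact (IsProjective.iff_projective _).mpr
    (projective_iff_hasProjectiveDimensionLT_one.mpr h1)

/-- Finitely supported functions into a product. -/
noncomputable def Finsupp.prodLEquiv (V : Type*) [CommRing V] (α K K' : Type*) [AddCommGroup K]
    [Module V K] [AddCommGroup K'] [Module V K'] :
    (α →₀ K × K') ≃ₗ[V] (α →₀ K) × (α →₀ K') :=
  LinearEquiv.ofLinearMap
    ((Finsupp.mapRange.linearMap (LinearMap.fst V K K')).prod
      (Finsupp.mapRange.linearMap (LinearMap.snd V K K')))
    ((Finsupp.mapRange.linearMap (LinearMap.inl V K K')).coprod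
      (Finsupp.mapRange.linearMap (LinearMap.inr V K K')))
    (by
      refine LinearMap.ext fun x => Prod.ext ?_ ?_ <;> ext a <;> simp)
    (by
      refine LinearMap.ext fun x => Finsupp.ext fun a => Prod.ext ?_ ?_ <;> simp)

/-- The Eilenberg swindle: a projective module becomes free after adding a free module. -/
theorem Module.Projective.exists_free_prod {V : Type u} [CommRing V] (K : Type u) [AddCommGroup K]
    [Module V K] [hK : Module.Projective V K] :
    ∃ G : Type u, Module.Free V ((G →₀ V) × K) := by
  obtain ⟨s, hs⟩ := Module.projective_def'.mp hK
  set p : (K →₀ V) →ₗ[V] K := Finsupp.linearCombination V id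
  have hps : ∀ x, p (s x) = x := fun x => LinearMap.congr_fun hs x
  let e : (K →₀ V) ≃ₗ[V] K × LinearMap.ker p :=
    LinearEquiv.ofLinearMap
      (p.prod ((LinearMap.id - s ∘ₗ p).codRestrict _ fun x => by simp [hps]))
      (s.coprod (LinearMap.ker p).subtype)
      (by
        refine LinearMap.ext fun x => Prod.ext ?_ (Subtype.ext ?_)
        · simp [hps]
        · simp [hps])
      (by
        refine LinearMap.ext fun x => ?_
        simp)
  let e₁ : (ℕ →₀ (K →₀ V)) ≃ₗ[V] (ℕ →₀ K) × (ℕ →₀ LinearMap.ker p) :=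
    Finsupp.mapRange.linearEquiv e ≪≫ₗ Finsupp.prodLEquiv V ℕ K (LinearMap.ker p)
  -- Countably many copies of `K` absorb one more copy; after the splitting `e`, so does the free
  -- module `ℕ →₀ (K →₀ V)`.
  let e₂ : ((ℕ →₀ K) × K) ≃ₗ[V] (ℕ →₀ K) :=
    (LinearEquiv.prodCongr (LinearEquiv.refl V _)
      (Finsupp.uniqueLinearEquiv V K PUnit.unit.{1}).symm) ≪≫ₗ
      (Finsupp.sumFinsuppLEquivProdFinsupp V).symm ≪≫ₗ
      Finsupp.domLCongr Equiv.natSumPUnitEquivNat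
  let e₃ : ((ℕ →₀ (K →₀ V)) × K) ≃ₗ[V] (ℕ →₀ (K →₀ V)) :=
    (LinearEquiv.prodCongr e₁ (LinearEquiv.refl V K)) ≪≫ₗ LinearEquiv.prodAssoc V _ _ _ ≪≫ₗ
      (LinearEquiv.prodCongr (LinearEquiv.refl V _) (LinearEquiv.prodComm V _ _)) ≪≫ₗ
      (LinearEquiv.prodAssoc V _ _ _).symm ≪≫ₗ
      (LinearEquiv.prodCongr e₂ (LinearEquiv.refl V _)) ≪≫ₗ e₁.symm
  exact ⟨ℕ × K, Module.Free.of_equiv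
    ((LinearEquiv.prodCongr (Finsupp.curryLinearEquiv V) (LinearEquiv.refl V K)) ≪≫ₗ e₃).symm⟩

/-- Modules of projective dimension at most one over a ring have resolutions of length one by free
modules. -/
theorem IsObject.exists_free_presentation {V : Type u} [CommRing V] {M : Type u} [AddCommGroup M]
    [Module V M] (hM : IsObject V M) :
    ∃ (B C : Type u) (κ : (C →₀ V) →ₗ[V] (B →₀ V)) (π : (B →₀ V) →ₗ[V] M),
      Function.Injective κ ∧ Function.Surjective π ∧ Function.Exact κ π := by
  let π₀ : (M →₀ V) →ₗ[V] M := Finsupp.linearCombination V (id : M → M)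
  have hπ₀ : Function.Surjective π₀ := Finsupp.linearCombination_id_surjective V M
  have hP : Module.Projective V ↥(LinearMap.ker π₀) :=
    hM.projective_ker π₀ hπ₀
  obtain ⟨G, hG⟩ := Module.Projective.exists_free_prod (V := V) ↥(LinearMap.ker π₀)
  let b := Module.Free.chooseBasis V ((G →₀ V) × LinearMap.ker π₀)
  let e := Finsupp.sumFinsuppLEquivProdFinsupp (M := V) V (α := G) (β := M)
  -- The free summand that makes the relations free is added to the generators too, where it is sent
  -- to zero in `M`.
  refine ⟨G ⊕ M, _, e.symm.toLinearMap ∘ₗ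
    (LinearMap.prodMap LinearMap.id (LinearMap.ker π₀).subtype) ∘ₗ b.repr.symm.toLinearMap,
    π₀ ∘ₗ LinearMap.snd V _ _ ∘ₗ e.toLinearMap, ?_, ?_, ?_⟩
  · exact e.symm.injective.comp ((Function.injective_id.prodMap
      (Submodule.subtype_injective _)).comp b.repr.symm.injective)
  · exact hπ₀.comp (Prod.snd_surjective.comp e.surjective)
  · intro x
    obtain ⟨y, rfl⟩ := e.symm.surjective x
    constructor
    · intro hy
      refine ⟨b.repr (y.1, ⟨y.2, by simpa using hy⟩), ?_⟩
      simp
    · rintro ⟨z, hz⟩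
      have hz' := e.symm.injective hz
      rw [← hz']
      simp

/-! ### Elimination over a valuation domain -/

/-- A nonempty finite family has an element dividing all others. -/
theorem exists_dvd_forall {V ι : Type*} [CommRing V] [IsDomain V] [ValuationRing V] (s : Finset ι) (hs : s.Nonempty) (f : ι → V) :
    ∃ i ∈ s, ∀ k ∈ s, f i ∣ f k := by
  induction hs using Finset.Nonempty.cons_induction with
  | singleton a => exact ⟨a, by simp, by simp⟩
  | cons a s h hs ih =>
    obtain ⟨c, hc, hc'⟩ := ih
    rcases ValuationRing.dvd_total (f a) (f c) with h1 | h1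
    · exact ⟨a, by simp, by simpa using fun x hx => h1.trans (hc' x hx)⟩
    · exact ⟨c, by simp [hc], by simpa using ⟨h1, hc'⟩⟩

/-- A finitely generated submodule of a free module of finite rank over a valuation domain is,
in a suitable basis, defined by divisibility conditions on the coordinates. -/
theorem exists_equiv_mem_iff_dvd {V : Type*} [CommRing V] [IsDomain V] [ValuationRing V] :
    ∀ (n : ℕ) (R : Submodule V (Fin n → V)), R.FG →
      ∃ (e : (Fin n → V) ≃ₗ[V] (Fin n → V)) (d : Fin n → V),
        ∀ f, f ∈ R ↔ ∀ i, d i ∣ e f i := by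
  classical
  intro n
  induction n with
  | zero =>
    intro R _
    refine ⟨LinearEquiv.refl _ _, 0, fun f => ⟨fun _ i => i.elim0, fun _ => ?_⟩⟩
    rw [Subsingleton.elim f 0]
    exact R.zero_mem
  | succ n ih =>
    intro R hR
    -- Pivot: an entry dividing all entries of all elements of `R`, found among the entries of
    -- finitely many generators. The inserted `0` keeps the set nonempty and is the pivot only if `R
    -- = 0`.
    obtain ⟨r, hr, j, hj⟩ : ∃ r ∈ R, ∃ j, ∀ r' ∈ R, ∀ k, r j ∣ r' k := by
      obtain ⟨S, hS⟩ := hR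
      let T : Finset V := insert 0 ((S ×ˢ Finset.univ).image fun p => p.1 p.2)
      obtain ⟨c, hcT, hc⟩ : ∃ c ∈ T, ∀ c' ∈ T, c ∣ c' := by
        exact exists_dvd_forall T ⟨0, by simp [T]⟩ id
      have key : ∀ r' ∈ R, ∀ k, c ∣ r' k := by
        intro r' hr' k
        rw [← hS] at hr'
        induction hr' using Submodule.span_induction with
        | mem x hx =>
          refine hc _ (Finset.mem_insert_of_mem (Finset.mem_image.mpr ⟨(x, k), ?_, rfl⟩))
          simpa using hx
        | zero => exact dvd_zero _
        | add x y _ _ hx hy => exact dvd_add hx hy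
        | smul a x _ hx => exact hx.mul_left a
      rcases Finset.mem_insert.mp hcT with h0 | h0
      · exact ⟨0, R.zero_mem, 0, by simpa [h0] using key⟩
      · obtain ⟨⟨r, j⟩, hrj, rfl⟩ := Finset.mem_image.mp h0
        exact ⟨r, hS ▸ Submodule.subset_span (by simpa using hrj), j, key⟩
    choose q hq using fun k => hj r hr k
    -- `σ` subtracts from `f` the vector `f j • q` and drops coordinate `j`; it kills the pivot row
    -- `r = r j • q`.
    let σ : (Fin (n + 1) → V) →ₗ[V] (Fin n → V) :=
      LinearMap.pi fun k => LinearMap.proj (j.succAbove k) - q (j.succAbove k) • LinearMap.proj j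
    have hσ : ∀ f k, σ f k = f (j.succAbove k) - q (j.succAbove k) * f j := fun f k => rfl
    have hσr : σ r = 0 := by
      ext k
      rw [hσ, hq (j.succAbove k)]
      simp [mul_comm]
    obtain ⟨e, d, hed⟩ := ih (R.map σ) (hR.map σ)
    have key : ∀ f, f ∈ R ↔ r j ∣ f j ∧ σ f ∈ R.map σ := by
      refine fun f => ⟨fun hf => ⟨hj f hf j, Submodule.mem_map_of_mem hf⟩, ?_⟩
      rintro ⟨⟨β, hβ⟩, f', hf', hff⟩
      obtain ⟨β', hβ'⟩ := hj f' hf' j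
      have : f = f' + (β - β') • r := by
        ext k
        rcases Fin.eq_self_or_eq_succAbove j k with rfl | ⟨k, rfl⟩
        · simp only [Pi.add_apply, Pi.smul_apply, smul_eq_mul, hβ, hβ']; ring
        · have := congrFun hff k
          rw [hσ, hσ] at this
          simp only [Pi.add_apply, Pi.smul_apply, smul_eq_mul]
          rw [hq (j.succAbove k)]
          rw [hβ, hβ'] at this
          linear_combination -this
      rw [this]
      exact R.add_mem hf' (R.smul_mem _ hr)
    let E : (Fin (n + 1) → V) →ₗ[V] (Fin (n + 1) → V) :=
      LinearMap.pi (Fin.cons (LinearMap.proj j) fun k => LinearMap.proj k ∘ₗ e.toLinearMap ∘ₗ σ)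
    have hE0 : ∀ f, E f 0 = f j := fun f => rfl
    have hEs : ∀ f k, E f (Fin.succ k) = e (σ f) k := fun f k => rfl
    have hE : Function.Bijective E := by
      constructor
      · rw [injective_iff_map_eq_zero]
        intro f hf
        have h0 : f j = 0 := by rw [← hE0 f, hf]; rfl
        have h1 : σ f = 0 := by
          apply e.injective
          ext k
          rw [← hEs, hf]; simp
        ext k
        rcases Fin.eq_self_or_eq_succAbove j k with rfl | ⟨k, rfl⟩
        · simpa using h0
        · have := congrFun h1 k
          rw [hσ, h0] at this
          simpa using this
      · intro g
        refine ⟨j.insertNth (g 0) fun k => e.symm (Fin.tail g) k + q (j.succAbove k) * g 0, ?_⟩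
        ext k
        refine Fin.cases ?_ (fun k => ?_) k
        · rw [hE0]; simp
        · rw [hEs]
          have : σ (j.insertNth (g 0) fun k => e.symm (Fin.tail g) k + q (j.succAbove k) * g 0) =
              e.symm (Fin.tail g) := by
            ext k
            rw [hσ]; simp
          rw [this]
          simp [Fin.tail]
    refine ⟨LinearEquiv.ofBijective E hE, Fin.cons (r j) d, fun f => ?_⟩
    rw [key, hed, Fin.forall_fin_succ]
    rfl

/-- Induction on the rank bound: if `p ∈ P` has a nonzero image in coordinate `0`, cross-multiplying
any other element with `p` cancels that coordinate, so only the finite support of `p` has to be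
added. -/
theorem exists_finset_supported_of_finite_rank {V C : Type*} [CommRing V] [IsDomain V] :
    ∀ (n : ℕ) (P : Submodule V (C →₀ V)) (h : (C →₀ V) →ₗ[V] (Fin n → V)),
      (∀ p ∈ P, h p = 0 → p = 0) → ∃ Y : Finset C, P ≤ Finsupp.supported V V (Y : Set C) := by
  classical
  intro n
  induction n with
  | zero =>
    intro P h hP
    refine ⟨∅, fun p hp => ?_⟩
    rw [hP p hp (Subsingleton.elim _ _)]
    exact Submodule.zero_mem _
  | succ n ih =>
    intro P h hP
    obtain ⟨Y, hY⟩ := ih (P ⊓ LinearMap.ker (LinearMap.proj 0 ∘ₗ h))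
      (LinearMap.funLeft V V Fin.succ ∘ₗ h) (by
        rintro p ⟨hp, hp0⟩ hp1
        refine hP p hp ?_
        ext k
        refine Fin.cases hp0 (fun k => ?_) k
        exact congrFun hp1 k)
    by_cases hall : ∀ p ∈ P, h p 0 = 0
    · exact ⟨Y, fun p hp => hY ⟨hp, hall p hp⟩⟩
    · push Not at hall
      obtain ⟨p, hp, hp0⟩ := hall
      refine ⟨Y ∪ p.support, fun p' hp' c hc => ?_⟩
      have h1 : (h p 0 • p' - h p' 0 • p) ∈ Finsupp.supported V V (Y : Set C) := by
        refine hY ⟨P.sub_mem (P.smul_mem _ hp') (P.smul_mem _ hp), ?_⟩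
        simp [mul_comm]
      by_contra hcY
      simp only [Finset.coe_union, Set.mem_union, Finset.mem_coe, Finsupp.mem_support_iff, not_or,
        not_not] at hcY
      have h2 := (Finsupp.mem_supported' V _).mp h1 c hcY.1
      simp [hcY.2, hp0] at h2
      simp [h2] at hc

/-! ### Finite parts of an object -/

section FreePresentation

variable {V : Type*} [CommRing V] [IsDomain V] [ValuationRing V]

omit [ValuationRing V] in
theorem exists_finset_supported_of_map_mem {B C : Type*} (κ : (C →₀ V) →ₗ[V] (B →₀ V))
    (hκ : Function.Injective κ) (X : Finset B) :
    ∃ Y : Finset C, ∀ k, κ k ∈ Finsupp.supported V V (X : Set B) →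
      k ∈ Finsupp.supported V V (Y : Set C) := by
  obtain ⟨Y, hY⟩ := exists_finset_supported_of_finite_rank X.card
    ((Finsupp.supported V V (X : Set B)).comap κ)
    (LinearMap.pi (fun i => Finsupp.lapply (X.equivFin.symm i : B)) ∘ₗ κ) (by
      intro k hk hk0
      apply hκ
      rw [map_zero]
      ext b
      by_cases hb : b ∈ X
      · have := congrFun hk0 (X.equivFin ⟨b, hb⟩)
        simpa using this
      · exact (Finsupp.mem_supported' V _).mp hk b hb)
  exact ⟨Y, hY⟩

/-- Over a valuation domain, a submodule of finite rank that is the kernel of a map between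
torsion-free modules is finitely generated. -/
theorem fg_comap_supported {B C : Type*} (κ : (C →₀ V) →ₗ[V] (B →₀ V))
    (hκ : Function.Injective κ) (X : Finset B) :
    ((Finsupp.supported V V (X : Set B)).comap κ).FG := by
  classical
  obtain ⟨Y, hY⟩ := exists_finset_supported_of_map_mem κ hκ X
  let ι : (Y →₀ V) →ₗ[V] (C →₀ V) := Finsupp.lmapDomain V V (fun y : Y => (y : C))
  let g : (Y →₀ V) →ₗ[V] (((X : Set B)ᶜ : Set B) →₀ V) :=
    Finsupp.lsubtypeDomain ((X : Set B)ᶜ) ∘ₗ κ ∘ₗ ι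
  -- The range of `g` is finitely generated and torsion-free, hence flat, hence free over the local
  -- ring `V`. So it is finitely presented and the kernel of `g`, which describes the relations
  -- supported on `X`, is finitely generated.
  have hflat : Module.Flat V (LinearMap.range g) :=
    (Module.Flat.flat_iff_torsion_eq_bot_of_isBezout (R := V) (M := LinearMap.range g)).mpr
      ((Submodule.isTorsionFree_iff_torsion_eq_bot (R := V) (M := LinearMap.range g)).mp
        inferInstance)
  have hfree : Module.Free V (LinearMap.range g) :=
    Module.free_of_flat_of_isLocalRing (P := LinearMap.range g)
  have hker : (LinearMap.ker g).FG := by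
    rw [← LinearMap.ker_rangeRestrict]
    have : Module.FinitePresentation V (LinearMap.range g) :=
      Module.finitePresentation_of_projective V (LinearMap.range g)
    exact Module.FinitePresentation.fg_ker (N := LinearMap.range g) g.rangeRestrict
      g.surjective_rangeRestrict
  convert hker.map ι
  ext k
  have hg : ∀ z, g z = 0 ↔ κ (ι z) ∈ Finsupp.supported V V (X : Set B) := by
    intro z
    rw [Finsupp.mem_supported', Finsupp.ext_iff]
    exact ⟨fun h b hb => h ⟨b, hb⟩, fun h b => h b.1 b.2⟩
  constructor
  · intro hk
    have hkY : ι (Finsupp.subtypeDomain (· ∈ Y) k) = k := by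
      ext c
      by_cases hc : c ∈ Y
      · exact Finsupp.mapDomain_apply Subtype.val_injective _ (⟨c, hc⟩ : Y)
      · rw [(Finsupp.mem_supported' V _).mp (hY k hk) c hc]
        exact Finsupp.mapDomain_of_notMem_range _ _ (by simpa using hc)
    refine ⟨_, (hg _).mpr ?_, hkY⟩
    rw [hkY]
    exact hk
  · rintro ⟨z, hz, rfl⟩
    exact (hg z).mp hz

/-- In a module of projective dimension one over a valuation domain, the submodules generated by
finitely many of the generators are direct sums of cyclically presented modules. -/
theorem exists_cyclic_decomposition {B C M : Type*} [AddCommGroup M] [Module V M]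
    {κ : (C →₀ V) →ₗ[V] (B →₀ V)} {π : (B →₀ V) →ₗ[V] M} (hκ : Function.Injective κ)
    (h : Function.Exact κ π) (X : Finset B) :
    ∃ (n : ℕ) (ρ : (Fin n → V) →ₗ[V] M) (d : Fin n → V),
      LinearMap.range ρ = (Finsupp.supported V V (X : Set B)).map π ∧
        ∀ f, ρ f = 0 ↔ ∀ i, d i ∣ f i := by
  classical
  let s : (B →₀ V) →ₗ[V] (Fin X.card → V) :=
    LinearMap.pi fun i => Finsupp.lapply (X.equivFin.symm i : B)
  let j : (Fin X.card → V) →ₗ[V] (B →₀ V) :=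
    Fintype.linearCombination V fun i => Finsupp.single (X.equivFin.symm i : B) 1
  have hsj : ∀ f, s (j f) = f := by
    intro f
    ext i
    simp [s, j, Fintype.linearCombination_apply, Finsupp.single_apply]
  have hjX : ∀ f, j f ∈ Finsupp.supported V V (X : Set B) := by
    intro f
    rw [Fintype.linearCombination_apply]
    refine Submodule.sum_mem _ fun i _ => Submodule.smul_mem _ _ ?_
    exact Finsupp.single_mem_supported V 1 (X.equivFin.symm i).2
  have hjs : ∀ x ∈ Finsupp.supported V V (X : Set B), j (s x) = x := by
    intro x hx
    ext b
    by_cases hb : b ∈ X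
    · have := congrFun (hsj (s x)) (X.equivFin ⟨b, hb⟩)
      simpa [s] using this
    · rw [(Finsupp.mem_supported' V _).mp hx b hb]
      exact (Finsupp.mem_supported' V _).mp (hjX _) b hb
  -- Under the identification of `Fin X.card → V` with the vectors supported on `X`, this kernel is
  -- the image of the relations supported on `X`.
  have hker : (LinearMap.ker (π ∘ₗ j)).FG := by
    have hfg := (fg_comap_supported κ hκ X).map (s ∘ₗ κ)
    convert hfg
    ext f
    constructor
    · intro hf
      obtain ⟨k, hk⟩ := (h (j f)).mp hf
      refine ⟨k, ?_, ?_⟩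
      · rw [SetLike.mem_coe, Submodule.mem_comap, hk]
        exact hjX f
      · simp [hk, hsj]
    · rintro ⟨k, hk, rfl⟩
      change π (j (s (κ k))) = 0
      rw [hjs _ hk]
      exact h.apply_apply_eq_zero k
  obtain ⟨e, d, hed⟩ := exists_equiv_mem_iff_dvd _ _ hker
  refine ⟨X.card, π ∘ₗ j ∘ₗ e.symm.toLinearMap, d, ?_, fun f => ?_⟩
  · ext m
    constructor
    · rintro ⟨f, rfl⟩
      exact ⟨_, hjX _, rfl⟩
    · rintro ⟨x, hx, rfl⟩
      exact ⟨e (s x), by simp [hjs x hx]⟩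
  · have := hed (e.symm f)
    rw [e.apply_symm_apply] at this
    exact this

omit [ValuationRing V] [IsDomain V] in
theorem exists_mem_map_supported {B M : Type*} [AddCommGroup M] [Module V M]
    {π : (B →₀ V) →ₗ[V] M} (hπ : Function.Surjective π) (m : M) :
    ∃ X : Finset B, m ∈ (Finsupp.supported V V (X : Set B)).map π := by
  obtain ⟨f, rfl⟩ := hπ m
  exact ⟨f.support, f, fun _ h => h, rfl⟩

/-- Annihilators of elements are principal in a module of projective dimension one. -/
theorem exists_smul_eq_zero_iff_dvd {B C M : Type*} [AddCommGroup M] [Module V M]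
    {κ : (C →₀ V) →ₗ[V] (B →₀ V)} {π : (B →₀ V) →ₗ[V] M} (hκ : Function.Injective κ)
    (hπ : Function.Surjective π) (h : Function.Exact κ π) (m : M) :
    ∃ d : V, ∀ v : V, v • m = 0 ↔ d ∣ v := by
  obtain ⟨X, hX⟩ := exists_mem_map_supported hπ m
  obtain ⟨n, ρ, d, hρ, hd⟩ := exists_cyclic_decomposition hκ h X
  rw [← hρ] at hX
  obtain ⟨f, rfl⟩ := hX
  -- Each coordinate has a principal annihilator; the annihilator of `m` is their finite
  -- intersection, again principal because divisibility is total.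
  have hc : ∀ i, ∃ c : V, ∀ v : V, d i ∣ v * f i ↔ c ∣ v := by
    intro i
    by_cases hf : f i = 0
    · exact ⟨1, by simp [hf]⟩
    rcases ValuationRing.dvd_total (d i) (f i) with h1 | ⟨c, hc⟩
    · exact ⟨1, fun v => by simp [h1.mul_left v]⟩
    · exact ⟨c, fun v => by rw [hc, mul_comm v, mul_dvd_mul_iff_left hf]⟩
  choose c hc using hc
  have hv : ∀ v : V, v • ρ f = 0 ↔ ∀ i, c i ∣ v := by
    intro v
    rw [← map_smul, hd]
    exact forall_congr' fun i => hc i v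
  have hmax : ∀ s : Finset (Fin n), ∃ d : V, ∀ v : V, d ∣ v ↔ ∀ i ∈ s, c i ∣ v := by
    classical
    intro s
    induction s using Finset.induction_on with
    | empty => exact ⟨1, by simp⟩
    | insert a s _ ih =>
      obtain ⟨d, hd⟩ := ih
      rcases ValuationRing.dvd_total (c a) d with h1 | h1
      · exact ⟨d, fun v => by
          rw [Finset.forall_mem_insert, ← hd]; exact ⟨fun h => ⟨h1.trans h, h⟩, And.right⟩⟩
      · exact ⟨c a, fun v => by
          rw [Finset.forall_mem_insert, ← hd]; exact ⟨fun h => ⟨h, h1.trans h⟩, And.left⟩⟩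
  obtain ⟨d', hd'⟩ := hmax Finset.univ
  exact ⟨d', fun v => by rw [hv, hd']; simp⟩

/-- Among the divisors of a nonzero element of a submodule generated by finitely many of the
generators of a module of projective dimension one, there is a largest one. -/
theorem exists_largest_divisor {B C M : Type*} [AddCommGroup M] [Module V M]
    {κ : (C →₀ V) →ₗ[V] (B →₀ V)} {π : (B →₀ V) →ₗ[V] M} (hκ : Function.Injective κ)
    (h : Function.Exact κ π) (X : Finset B) {a : M} (ha : a ≠ 0)
    (haX : a ∈ (Finsupp.supported V V (X : Set B)).map π) :
    ∃ t : V, (∃ y ∈ (Finsupp.supported V V (X : Set B)).map π, t • y = a) ∧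
      ∀ t' : V, ∀ y ∈ (Finsupp.supported V V (X : Set B)).map π, t' • y = a → t' ∣ t := by
  classical
  obtain ⟨n, ρ, d, hρ, hd⟩ := exists_cyclic_decomposition hκ h X
  rw [← hρ] at haX ⊢
  obtain ⟨f, rfl⟩ := haX
  -- These indices are the nonzero components of `a`. The entry `f i₀` dividing all the others among
  -- them is the largest divisor.
  have hne : (Finset.univ.filter fun i => ¬ d i ∣ f i).Nonempty := by
    by_contra hemp
    apply ha
    rw [hd]
    intro i
    by_contra hi
    exact hemp ⟨i, by simpa using hi⟩
  obtain ⟨i₀, hi₀, hmin⟩ := exists_dvd_forall _ hne f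
  simp only [Finset.mem_filter, Finset.mem_univ, true_and] at hi₀ hmin
  refine ⟨f i₀, ?_, ?_⟩
  · have hg : ∀ i, ∃ g : V, d i ∣ f i - f i₀ * g := by
      intro i
      by_cases hi : d i ∣ f i
      · exact ⟨0, by simpa using hi⟩
      · obtain ⟨g, hg⟩ := hmin i hi
        exact ⟨g, by simp [hg]⟩
    choose g hg using hg
    refine ⟨ρ g, ⟨g, rfl⟩, ?_⟩
    rw [← map_smul, eq_comm, ← sub_eq_zero, ← map_sub, hd]
    exact hg
  · rintro t' _ ⟨g, rfl⟩ hga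
    rw [← map_smul, eq_comm, ← sub_eq_zero, ← map_sub, hd] at hga
    obtain ⟨w, hw⟩ := hga i₀
    -- Here `d i₀ = f i₀ * u` with `u` a non-unit, so passing to the quotient by `d i₀` changes `f
    -- i₀` only by the unit factor `1 - u * w`.
    rcases ValuationRing.dvd_total (d i₀) (f i₀) with h1 | ⟨u, hu⟩
    · exact absurd h1 hi₀
    have hunit : IsUnit (1 - u * w) := by
      rcases IsLocalRing.isUnit_or_isUnit_one_sub_self (u * w) with h1 | h1
      · have hu' : IsUnit u := isUnit_of_mul_isUnit_left h1
        refine absurd ?_ hi₀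
        rw [hu]
        exact (hu'.dvd_mul_right).mp dvd_rfl |>.trans dvd_rfl
      · exact h1
    have : t' * g i₀ = f i₀ * (1 - u * w) := by
      simp only [Pi.sub_apply, Pi.smul_apply, smul_eq_mul] at hw
      linear_combination -hu * w - hw
    exact (hunit.dvd_mul_right).mp ⟨g i₀, this.symm⟩

end FreePresentation

/-! ### Uniserial submodules of objects -/

section Uniserial

variable {V : Type*} [CommRing V]

theorem IsUniserial.smul_total {U : Type*} [AddCommGroup U] [Module V U] (h : IsUniserial V U)
    (x y : U) : (∃ v : V, v • x = y) ∨ ∃ v : V, v • y = x := by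
  rcases h (V ∙ x) (V ∙ y) with h | h
  · exact Or.inr (Submodule.mem_span_singleton.mp (h (Submodule.mem_span_singleton_self x)))
  · exact Or.inl (Submodule.mem_span_singleton.mp (h (Submodule.mem_span_singleton_self y)))

theorem IsUniserial.of_smul_total {U : Type*} [AddCommGroup U] [Module V U]
    (h : ∀ x y : U, (∃ v : V, v • x = y) ∨ ∃ v : V, v • y = x) : IsUniserial V U := by
  intro A B
  by_contra! hAB
  obtain ⟨x, hxA, hxB⟩ := SetLike.not_le_iff_exists.mp hAB.1
  obtain ⟨y, hyB, hyA⟩ := SetLike.not_le_iff_exists.mp hAB.2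
  rcases h x y with ⟨v, rfl⟩ | ⟨v, rfl⟩
  · exact hyA (A.smul_mem v hxA)
  · exact hxB (B.smul_mem v hyB)

theorem IsUniserial.smul_total_of_mem {M : Type*} [AddCommGroup M] [Module V M]
    {W : Submodule V M} (h : IsUniserial V W) {x y : M} (hx : x ∈ W) (hy : y ∈ W) :
    (∃ v : V, v • x = y) ∨ ∃ v : V, v • y = x := by
  rcases h.smul_total ⟨x, hx⟩ ⟨y, hy⟩ with ⟨v, hv⟩ | ⟨v, hv⟩
  · exact Or.inl ⟨v, congrArg Subtype.val hv⟩
  · exact Or.inr ⟨v, congrArg Subtype.val hv⟩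

/-- The map of free modules induced by the inclusion of a set of basis elements. -/
noncomputable def Finsupp.inclusionOfSet (V : Type*) [CommRing V] {B : Type*} (X : Set B) :
    (X →₀ V) →ₗ[V] (B →₀ V) :=
  (Finsupp.supported V V X).subtype ∘ₗ (Finsupp.supportedEquivFinsupp X).symm.toLinearMap

theorem Finsupp.inclusionOfSet_injective {B : Type*} (X : Set B) :
    Function.Injective (Finsupp.inclusionOfSet V X) :=
  (Submodule.subtype_injective _).comp (LinearEquiv.injective _)

theorem Finsupp.inclusionOfSet_mem {B : Type*} (X : Set B) (x : X →₀ V) :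
    Finsupp.inclusionOfSet V X x ∈ Finsupp.supported V V X :=
  Subtype.prop _

theorem Finsupp.exists_inclusionOfSet_eq {B : Type*} {X : Set B} {x : B →₀ V}
    (hx : x ∈ Finsupp.supported V V X) : ∃ y, Finsupp.inclusionOfSet V X y = x :=
  ⟨Finsupp.supportedEquivFinsupp X ⟨x, hx⟩, by simp [Finsupp.inclusionOfSet]⟩

variable [IsDomain V] [ValuationRing V] {B C M : Type*} [AddCommGroup M] [Module V M]
    {κ : (C →₀ V) →ₗ[V] (B →₀ V)} {π : (B →₀ V) →ₗ[V] M}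

/-- If a set `X` of generators is closed with respect to the relations, then the conductors of
elements into the submodule generated by `X` are principal. -/
theorem exists_smul_mem_map_supported_iff_dvd
    (hπ : Function.Surjective π) (h : Function.Exact κ π) (X : Set B)
    (hX : ∀ k, κ k ∈ Finsupp.supported V V X →
      ∀ c ∈ k.support, κ (Finsupp.single c 1) ∈ Finsupp.supported V V X) (m : M) :
    ∃ d : V, ∀ v : V, v • m ∈ (Finsupp.supported V V X).map π ↔ d ∣ v := by
  classical
  let Z : Set C := {c | κ (Finsupp.single c 1) ∈ Finsupp.supported V V X}
  have hZ : ∀ k ∈ Finsupp.supported V V Z, κ k ∈ Finsupp.supported V V X := by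
    intro k hk
    rw [Finsupp.supported_eq_span_single] at hk
    induction hk using Submodule.span_induction with
    | mem x hx => obtain ⟨c, hc, rfl⟩ := hx; exact hc
    | zero => rw [map_zero]; exact Submodule.zero_mem _
    | add x y _ _ hx hy => rw [map_add]; exact Submodule.add_mem _ hx hy
    | smul a x _ hx => rw [map_smul]; exact Submodule.smul_mem _ _ hx
  let N := (Finsupp.supported V V X).map π
  -- A free presentation of `M ⧸ N`: the generators in `X` become relations and replace the
  -- relations in `Z`, which they already imply. Closedness of `X` gives injectivity, so conductors
  -- into `N` are annihilators in a module with a free presentation of length one.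
  let κ' : ((X ⊕ (Zᶜ : Set C)) →₀ V) →ₗ[V] (B →₀ V) :=
    (LinearMap.coprod (Finsupp.inclusionOfSet V X) (κ ∘ₗ Finsupp.inclusionOfSet V Zᶜ)) ∘ₗ
      (Finsupp.sumFinsuppLEquivProdFinsupp V).toLinearMap
  have hκ' : Function.Injective κ' := by
    refine Function.Injective.comp (g := LinearMap.coprod _ _) ?_ (LinearEquiv.injective _)
    rw [injective_iff_map_eq_zero]
    rintro ⟨x, k⟩ hxk
    have h0 : Finsupp.inclusionOfSet V X x + κ (Finsupp.inclusionOfSet V Zᶜ k) = 0 := hxk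
    have h1 : κ (Finsupp.inclusionOfSet V Zᶜ k) ∈ Finsupp.supported V V X := by
      rw [eq_neg_of_add_eq_zero_right h0]
      exact Submodule.neg_mem _ (Finsupp.inclusionOfSet_mem X x)
    have h2 : Finsupp.inclusionOfSet V Zᶜ k = 0 := by
      rw [← Finsupp.support_eq_empty, Finset.eq_empty_iff_forall_notMem]
      exact fun c hc => Finsupp.inclusionOfSet_mem Zᶜ k hc (hX _ h1 c hc)
    rw [h2, map_zero, add_zero] at h0
    exact Prod.ext (Finsupp.inclusionOfSet_injective X (by simpa using h0))
      (Finsupp.inclusionOfSet_injective Zᶜ (by simpa using h2))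
  have hex : Function.Exact κ' (N.mkQ ∘ₗ π) := by
    intro f
    rw [LinearMap.comp_apply, Submodule.mkQ_apply, Submodule.Quotient.mk_eq_zero]
    constructor
    · rintro ⟨x, hx, hxf⟩
      obtain ⟨k, hk⟩ := (h (f - x)).mp (by rw [map_sub, hxf, sub_self])
      have hdec : k = k.filter (· ∈ Z) + k.filter (· ∈ Zᶜ) :=
        (Finsupp.filter_add_filter_not k (· ∈ Z)).symm
      have h1 : k.filter (· ∈ Z) ∈ Finsupp.supported V V Z := by
        intro c hc
        simp only [Finset.mem_coe, Finsupp.support_filter, Finset.mem_filter] at hc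
        exact hc.2
      have h2 : k.filter (· ∈ Zᶜ) ∈ Finsupp.supported V V Zᶜ := by
        intro c hc
        simp only [Finset.mem_coe, Finsupp.support_filter, Finset.mem_filter] at hc
        exact hc.2
      obtain ⟨y, hy⟩ := Finsupp.exists_inclusionOfSet_eq (Submodule.add_mem _ hx (hZ _ h1))
      obtain ⟨z, hz⟩ := Finsupp.exists_inclusionOfSet_eq h2
      refine ⟨(Finsupp.sumFinsuppLEquivProdFinsupp V).symm (y, z), ?_⟩
      have : κ' ((Finsupp.sumFinsuppLEquivProdFinsupp V).symm (y, z)) =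
          Finsupp.inclusionOfSet V X y + κ (Finsupp.inclusionOfSet V Zᶜ z) := by
        simp [κ']
      rw [this, hy, hz, add_assoc, ← map_add, ← hdec, hk]
      abel
    · rintro ⟨z, rfl⟩
      refine ⟨Finsupp.inclusionOfSet V X (Finsupp.sumFinsuppLEquivProdFinsupp V z).1,
        Finsupp.inclusionOfSet_mem X _, ?_⟩
      have : κ' z = Finsupp.inclusionOfSet V X (Finsupp.sumFinsuppLEquivProdFinsupp V z).1 +
        κ (Finsupp.inclusionOfSet V Zᶜ (Finsupp.sumFinsuppLEquivProdFinsupp V z).2) := rfl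
      rw [this, map_add, h.apply_apply_eq_zero, add_zero]
  obtain ⟨d, hd⟩ := exists_smul_eq_zero_iff_dvd hκ' ((Submodule.mkQ_surjective N).comp hπ) hex
    (N.mkQ m)
  refine ⟨d, fun v => ?_⟩
  rw [← hd, ← map_smul, Submodule.mkQ_apply, Submodule.Quotient.mk_eq_zero]

/-- A uniserial submodule of a module of projective dimension one over a valuation domain is
contained in a submodule generated by countably many of the generators. -/
theorem IsUniserial.exists_countable_le_map_supported (hκ : Function.Injective κ)
    (hπ : Function.Surjective π) (h : Function.Exact κ π) {W : Submodule V M}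
    (hW : IsUniserial V W) :
    ∃ X : Set B, X.Countable ∧ W ≤ (Finsupp.supported V V X).map π := by
  classical
  by_contra! hcon
  have hw : ∀ X : {X : Set B // X.Countable}, ∃ w ∈ W,
      w ∉ (Finsupp.supported V V X.1).map π := fun X =>
    SetLike.not_le_iff_exists.mp (hcon X.1 X.2)
  choose w hwW hwX using hw
  choose f hf using fun X => hπ (w X)
  choose Y hY using exists_finset_supported_of_map_mem κ hκ
  -- One step adjoins the generators needed to express the element `w X ∈ W` that escapes `X`, and
  -- those occurring in the basic relations that enter relations supported on `X`. The union `T` of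
  -- the iterates is countable and closed.
  let step : {X : Set B // X.Countable} → {X : Set B // X.Countable} := fun X =>
    ⟨X.1 ∪ (f X).support ∪ ⋃ S : Finset X.1, ⋃ c ∈ Y (S.map (Function.Embedding.subtype _)),
      (κ (Finsupp.single c 1)).support, by
      have : Countable X.1 := X.2
      refine (X.2.union (Finset.countable_toSet _)).union (Set.countable_iUnion fun S => ?_)
      exact (Finset.countable_toSet _).biUnion fun c _ => Finset.countable_toSet _⟩
  let X : ℕ → {X : Set B // X.Countable} := fun n => step^[n] ⟨∅, Set.countable_empty⟩
  have hXs : ∀ n, X (n + 1) = step (X n) := fun n => Function.iterate_succ_apply' _ _ _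
  have hmono : Monotone fun n => (X n).1 := by
    refine monotone_nat_of_le_succ fun n => ?_
    rw [hXs]
    exact Set.subset_union_left.trans Set.subset_union_left
  let T : {X : Set B // X.Countable} := ⟨⋃ n, (X n).1, Set.countable_iUnion fun n => (X n).2⟩
  have hT : ∀ x ∈ Finsupp.supported V V T.1, ∃ n, x ∈ Finsupp.supported V V (X n).1 :=
    fun x hx => hmono.directed_le.exists_mem_subset_of_finset_subset_biUnion hx
  have hTX : ∀ n, Finsupp.supported V V (X n).1 ≤ Finsupp.supported V V T.1 :=
    fun n => Finsupp.supported_mono (Set.subset_iUnion (fun n => (X n).1) n)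
  have hclosed : ∀ k, κ k ∈ Finsupp.supported V V T.1 →
      ∀ c ∈ k.support, κ (Finsupp.single c 1) ∈ Finsupp.supported V V T.1 := by
    intro k hk c hc
    obtain ⟨n, hn⟩ := hT _ hk
    have hS : ((κ k).support.subtype (· ∈ (X n).1)).map (Function.Embedding.subtype _) =
        (κ k).support := Finset.subtype_map_of_mem fun x hx => hn hx
    have hcY : c ∈ Y (((κ k).support.subtype (· ∈ (X n).1)).map
        (Function.Embedding.subtype _)) := by
      rw [hS]
      exact hY (κ k).support k (fun _ hx => hx) hc
    refine hTX (n + 1) ?_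
    rw [hXs]
    refine fun b hb => Or.inr ?_
    simp only [Set.mem_iUnion]
    exact ⟨_, c, hcY, hb⟩
  -- The multiple `d • w T` generates all multiples of `w T` in the part given by `T`, and already
  -- lies in the part given by some `X n`. As `w (X n)` lies in the former but not the latter, it is
  -- not a multiple of `w T`; nor is `w T` a multiple of it, contradicting uniseriality.
  obtain ⟨d, hd⟩ := exists_smul_mem_map_supported_iff_dvd hπ h T.1 hclosed (w T)
  obtain ⟨u, hu, hud⟩ := (hd d).mpr dvd_rfl
  obtain ⟨n, hn⟩ := hT u hu
  have hwn : w (X n) ∈ (Finsupp.supported V V T.1).map π := by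
    refine ⟨f (X n), hTX (n + 1) ?_, hf _⟩
    rw [hXs]
    exact fun b hb => Or.inl (Or.inr hb)
  rcases hW.smul_total_of_mem (hwW T) (hwW (X n)) with ⟨v, hv⟩ | ⟨v, hv⟩
  · obtain ⟨e, rfl⟩ := (hd v).mp (hv ▸ hwn)
    refine hwX (X n) ?_
    rw [← hv, mul_comm, mul_smul, ← hud]
    exact Submodule.smul_mem _ _ ⟨u, hn, rfl⟩
  · exact hwX T (hv ▸ Submodule.smul_mem _ v hwn)

/-- A uniserial submodule of a module of projective dimension one over a valuation domain is
countably generated, or contained in a submodule generated by finitely many of the generators. -/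
theorem IsUniserial.countably_generated_or_le_map_supported (hκ : Function.Injective κ)
    (hπ : Function.Surjective π) (h : Function.Exact κ π) {W : Submodule V M}
    (hW : IsUniserial V W) :
    (∃ s : Set M, s.Countable ∧ Submodule.span V s = W) ∨
      ∃ X : Finset B, W ≤ (Finsupp.supported V V (X : Set B)).map π := by
  classical
  obtain ⟨X, hX, hWX⟩ := hW.exists_countable_le_map_supported hκ hπ h
  rcases X.eq_empty_or_nonempty with rfl | hne
  · exact Or.inr ⟨∅, by simpa using hWX⟩
  obtain ⟨b, rfl⟩ := hX.exists_eq_range hne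
  rw [or_iff_not_imp_right]
  intro hcon
  push Not at hcon
  choose w hwW hwX using fun X => SetLike.not_le_iff_exists.mp (hcon X)
  let Y : ℕ → Finset B := fun n => (Finset.range n).image b
  have hY : Monotone fun n => (Y n : Set B) := fun m n hmn =>
    Finset.coe_subset.mpr (Finset.image_subset_image (Finset.range_subset_range.mpr hmn))
  refine ⟨Set.range fun n => w (Y n), Set.countable_range _, le_antisymm ?_ ?_⟩
  · rw [Submodule.span_le]
    rintro _ ⟨n, rfl⟩
    exact hwW _
  · intro x hx
    obtain ⟨g, hg, rfl⟩ := hWX hx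
    obtain ⟨n, hn⟩ : ∃ n, (g.support : Set B) ⊆ Y n := by
      refine hY.directed_le.exists_mem_subset_of_finset_subset_biUnion fun y hy => ?_
      obtain ⟨n, rfl⟩ := hg hy
      exact Set.mem_iUnion.mpr ⟨n + 1, Finset.mem_coe.mpr
        (Finset.mem_image_of_mem b (Finset.self_mem_range_succ n))⟩
    -- Since `w (Y n)` lies outside the part containing `x`, it cannot be a multiple of `x`.
    rcases hW.smul_total_of_mem (hwW (Y n)) hx with ⟨v, hv⟩ | ⟨v, hv⟩
    · rw [← hv]
      exact Submodule.smul_mem _ _ (Submodule.subset_span ⟨n, rfl⟩)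
    · exact absurd (hv ▸ Submodule.smul_mem _ v ⟨g, hn, rfl⟩) (hwX (Y n))

end Uniserial

/-! ### Telescopes of cyclic modules -/

section Telescope

variable {V : Type*} [CommRing V] {U : Type*} [AddCommGroup U] [Module V U]

/-- A countably generated uniserial module is the union of an ascending sequence of cyclic
submodules, the first of which can be prescribed. -/
theorem IsUniserial.exists_sequence (hU : IsUniserial V U) {s : Set U} (hs : s.Countable)
    (hsU : Submodule.span V s = ⊤) (a : U) :
    ∃ (w : ℕ → U) (r : ℕ → V), w 0 = a ∧ (∀ n, r n • w (n + 1) = w n) ∧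
      ∀ x, ∃ n, ∃ v : V, v • w n = x := by
  obtain ⟨g, hg⟩ := (hs.insert 0).exists_eq_range (Set.insert_nonempty 0 s)
  have hc : ∀ x y : U, ∃ z : U, (∃ v : V, v • z = x) ∧ ∃ v : V, v • z = y := by
    intro x y
    rcases hU.smul_total x y with h | h
    · exact ⟨x, ⟨1, one_smul _ _⟩, h⟩
    · exact ⟨y, h, ⟨1, one_smul _ _⟩⟩
  choose z hz1 hz2 using hc
  let w : ℕ → U := fun n => Nat.rec a (fun n x => z x (g n)) n
  have hw : ∀ n, w (n + 1) = z (w n) (g n) := fun n => rfl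
  choose r hr using fun n => hz1 (w n) (g n)
  refine ⟨w, r, rfl, fun n => by rw [hw, hr], fun x => ?_⟩
  have hmono : Monotone fun n => Submodule.span V {w n} := by
    refine monotone_nat_of_le_succ fun n => ?_
    rw [Submodule.span_singleton_le_iff_mem, Submodule.mem_span_singleton]
    exact ⟨r n, by rw [hw, hr]⟩
  have hx : x ∈ ⨆ n, Submodule.span V {w n} := by
    have hle : Submodule.span V s ≤ ⨆ n, Submodule.span V {w n} := by
      rw [Submodule.span_le]
      intro y hy
      obtain ⟨n, rfl⟩ : y ∈ Set.range g := hg ▸ Set.mem_insert_of_mem 0 hy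
      exact Submodule.mem_iSup_of_mem (n + 1) (Submodule.mem_span_singleton.mpr (hz2 _ _))
    exact hle (hsU ▸ Submodule.mem_top)
  obtain ⟨n, hn⟩ := (Submodule.mem_iSup_of_directed _ hmono.directed_le).mp hx
  exact ⟨n, Submodule.mem_span_singleton.mp hn⟩

/-- The relations of the ascending union of cyclic modules with transition maps `r n`. -/
noncomputable def telescope (r : ℕ → V) : (ℕ →₀ V) →ₗ[V] (ℕ →₀ V) :=
  Finsupp.linearCombination V fun n => Finsupp.single n 1 - Finsupp.single (n + 1) (r n)

theorem telescope_single (r : ℕ → V) (n : ℕ) :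
    telescope r (Finsupp.single n 1) = Finsupp.single n 1 - Finsupp.single (n + 1) (r n) := by
  simp [telescope]

theorem telescope_apply_zero (r : ℕ → V) (k : ℕ →₀ V) : telescope r k 0 = k 0 := by
  induction k using Finsupp.induction_linear with
  | zero => simp
  | add f g hf hg => simp [hf, hg]
  | single n v =>
    rw [← mul_one v, ← smul_eq_mul, ← Finsupp.smul_single, map_smul, telescope_single]
    simp [Finsupp.single_apply]

theorem telescope_apply_succ (r : ℕ → V) (k : ℕ →₀ V) (m : ℕ) :
    telescope r k (m + 1) = k (m + 1) - r m * k m := by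
  induction k using Finsupp.induction_linear with
  | zero => simp
  | add f g hf hg => simp only [map_add, Finsupp.add_apply, hf, hg]; ring
  | single n v =>
    rw [← mul_one v, ← smul_eq_mul, ← Finsupp.smul_single, map_smul, telescope_single]
    simp only [Finsupp.smul_apply, Finsupp.sub_apply, Finsupp.single_apply, smul_eq_mul,
      Nat.add_right_cancel_iff]
    by_cases h : n = m
    · subst h; simp; ring
    · simp [h]

theorem telescope_injective (r : ℕ → V) : Function.Injective (telescope r) := by
  rw [injective_iff_map_eq_zero]
  intro k hk
  ext n
  induction n with
  | zero => rw [← telescope_apply_zero r, hk]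
  | succ n ih =>
    have := telescope_apply_succ r k n
    rw [hk, ih] at this
    simpa using this.symm

theorem map_telescope {r : ℕ → V} {w : ℕ → U} (hw : ∀ n, r n • w (n + 1) = w n) (k : ℕ →₀ V) :
    Finsupp.linearCombination V w (telescope r k) = 0 := by
  have : Finsupp.linearCombination V w ∘ₗ telescope r = 0 := by
    ext n
    simp [telescope_single, hw]
  exact LinearMap.congr_fun this k

/-- Modulo the relations, the basis vector at `n` is `r n` times the one at `n + 1`, so all terms
can be moved to a common later index. -/
theorem exists_sub_single_mem_range_telescope (r : ℕ → V) (f : ℕ →₀ V) :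
    ∃ (N : ℕ) (v : V), f - Finsupp.single N v ∈ LinearMap.range (telescope r) := by
  have hs : ∀ k n (v : V), ∃ v' : V, Finsupp.single n v - Finsupp.single (n + k) v' ∈
      LinearMap.range (telescope r) := by
    intro k
    induction k with
    | zero => exact fun n v => ⟨v, by simp⟩
    | succ k ih =>
      intro n v
      obtain ⟨v', hv'⟩ := ih n v
      refine ⟨v' * r (n + k), ?_⟩
      have := Submodule.add_mem _ hv'
        (Submodule.smul_mem _ v' (LinearMap.mem_range_self (telescope r) (.single (n + k) 1)))
      rw [telescope_single] at this
      simpa [smul_sub, add_assoc] using this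
  induction f using Finsupp.induction_linear with
  | zero => exact ⟨0, 0, by simp⟩
  | add f g hf hg =>
    obtain ⟨N, v, hv⟩ := hf
    obtain ⟨N', v', hv'⟩ := hg
    obtain ⟨u, hu⟩ := hs N' N v
    obtain ⟨u', hu'⟩ := hs N N' v'
    refine ⟨N + N', u + u', ?_⟩
    have := Submodule.add_mem _ (Submodule.add_mem _ hv hu) (Submodule.add_mem _ hv' hu')
    rw [add_comm N' N] at this
    rw [Finsupp.single_add]
    convert this using 1
    abel
  | single n v => exact ⟨n, v, by simp⟩

/-- A relation reduces to `v • w N = 0` at a single index, and torsion-freeness forces `v = 0`. -/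
theorem exact_telescope [IsDomain V] [Module.IsTorsionFree V U] {r : ℕ → V} {w : ℕ → U}
    (hw : ∀ n, r n • w (n + 1) = w n) (hw0 : w 0 ≠ 0) :
    Function.Exact (telescope r) (Finsupp.linearCombination V w) := by
  intro f
  refine ⟨fun hf => ?_, fun ⟨k, hk⟩ => hk ▸ map_telescope hw k⟩
  have hne : ∀ n, w n ≠ 0 := by
    intro n
    induction n with
    | zero => exact hw0
    | succ n ih => exact fun h => ih (by rw [← hw, h, smul_zero])
  obtain ⟨N, v, k, hk⟩ := exists_sub_single_mem_range_telescope r f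
  have h0 := map_telescope hw k
  rw [hk, map_sub, hf, zero_sub, neg_eq_zero, Finsupp.linearCombination_single] at h0
  have hv : v = 0 := (smul_eq_zero.mp h0).resolve_right (hne N)
  exact ⟨k, by rw [hk, hv]; simp⟩

end Telescope

/-- Countably generated torsion-free uniserial modules have projective dimension at most one. -/
theorem IsUniserial.isObject {V : Type u} [CommRing V] [IsDomain V] {U : Type u} [AddCommGroup U]
    [Module V U] [Module.IsTorsionFree V U] (hU : IsUniserial V U) {s : Set U} (hs : s.Countable)
    (hsU : Submodule.span V s = ⊤) {a : U} (ha : a ≠ 0) : IsObject V U := by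
  obtain ⟨w, r, rfl, hw, hsurj⟩ := hU.exists_sequence hs hsU a
  refine isObject_of_exact (telescope r) (Finsupp.linearCombination V w) (telescope_injective r) ?_
    (exact_telescope hw ha)
  intro x
  obtain ⟨n, v, rfl⟩ := hsurj x
  exact ⟨Finsupp.single n v, by simp⟩

/-! ### Countably generated uniserial modules are standard -/

section Standard

variable {V : Type*} [CommRing V] [IsDomain V] {Q : Type*} [Field Q] [Algebra V Q]
  [IsFractionRing V Q] {U : Type*} [AddCommGroup U] [Module V U]

omit [IsDomain V] [IsFractionRing V Q] in
theorem isStandardUniserial_of_surjective {J : Submodule V Q} (φ : J →ₗ[V] U)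
    (hφ : Function.Surjective φ) [Nontrivial U] : IsStandardUniserial V Q U := by
  have hsub : ((LinearMap.ker φ).map J.subtype).submoduleOf J = LinearMap.ker φ :=
    Submodule.comap_map_eq_of_injective J.subtype_injective _
  refine ⟨(LinearMap.ker φ).map J.subtype, J, lt_of_le_of_ne (Submodule.map_subtype_le _ _) ?_,
    ⟨((Submodule.quotEquivOfEq _ _ hsub).trans (φ.quotKerEquivOfSurjective hφ)).symm⟩⟩
  intro h
  obtain ⟨a, ha⟩ := exists_ne (0 : U)
  obtain ⟨x, rfl⟩ := hφ a
  have hx : x ∈ LinearMap.ker φ := by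
    rw [← hsub, h]
    exact x.2
  exact ha hx

/-- Countably generated uniserial modules over a valuation domain are standard. -/
theorem IsUniserial.isStandardUniserial (hU : IsUniserial V U) {s : Set U} (hs : s.Countable)
    (hsU : Submodule.span V s = ⊤) {a : U} (ha : a ≠ 0) : IsStandardUniserial V Q U := by
  obtain ⟨w, r, hw0, hw, hsurj⟩ := hU.exists_sequence hs hsU a
  have hr : ∀ n, r n ≠ 0 := by
    have hw' : ∀ n, w n ≠ 0 := by
      intro n
      induction n with
      | zero => rwa [hw0]
      | succ n ih => exact fun h => ih (by rw [← hw, h, smul_zero])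
    exact fun n h => hw' n (by rw [← hw, h, zero_smul])
  -- The inverse partial products satisfy the same recursion in `Q`, where by torsion-freeness the
  -- telescope gives all relations. Hence `q n ↦ w n` is a well-defined map from a submodule of `Q`
  -- onto `U`.
  let q : ℕ → Q := fun n => (algebraMap V Q (∏ i ∈ Finset.range n, r i))⁻¹
  have hq : ∀ n, r n • q (n + 1) = q n := by
    intro n
    have : algebraMap V Q (r n) ≠ 0 := by simpa using hr n
    simp only [q, Finset.prod_range_succ, map_mul, Algebra.smul_def]
    field_simp
  have hex := exact_telescope (V := V) (U := Q) (r := r) (w := q) hq (by simp [q])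
  let α := Finsupp.linearCombination V q
  let φ : LinearMap.range α →ₗ[V] U :=
    (LinearMap.ker α).liftQ (Finsupp.linearCombination V w) (fun f hf => by
      obtain ⟨k, rfl⟩ := (hex f).mp hf
      exact map_telescope hw k) ∘ₗ α.quotKerEquivRange.symm.toLinearMap
  have : Nontrivial U := ⟨a, 0, ha⟩
  refine isStandardUniserial_of_surjective φ ?_
  intro x
  obtain ⟨n, v, rfl⟩ := hsurj x
  exact ⟨α.quotKerEquivRange (Submodule.Quotient.mk (Finsupp.single n v)), by simp [φ]⟩

end Standard

/-! ### Height-ideals and divisibility -/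

section Heights

variable {V : Type*} [CommRing V] {Q : Type*} [Field Q] [Algebra V Q]
  {M N : Type*} [AddCommGroup M] [Module V M] [AddCommGroup N] [Module V N]

theorem AdmitsMap.map {J : Submodule V Q} {a : M} (h : AdmitsMap J a) (f : M →ₗ[V] N) :
    AdmitsMap J (f a) := by
  obtain ⟨h1, φ, rfl⟩ := h
  exact ⟨h1, f ∘ₗ φ, rfl⟩

theorem AdmitsMap.le_heightIdeal {J : Submodule V Q} {a : M} (h : AdmitsMap J a) :
    J ≤ heightIdeal Q a :=
  le_sSup h

theorem heightIdeal_le_map (a : M) (f : M →ₗ[V] N) :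
    heightIdeal (V := V) Q a ≤ heightIdeal Q (f a) :=
  sSup_le_sSup fun _ h => AdmitsMap.map h f

variable [IsDomain V] [IsFractionRing V Q]

theorem admitsMap_span_inv {t : V} (ht : t ≠ 0) {a y : M} (hy : t • y = a) :
    AdmitsMap (V ∙ (algebraMap V Q t)⁻¹) a := by
  have ht' : algebraMap V Q t ≠ 0 := by simpa using ht
  have h1 : t • (algebraMap V Q t)⁻¹ = 1 := by
    rw [Algebra.smul_def, mul_inv_cancel₀ ht']
  have hmem : (1 : Q) ∈ V ∙ (algebraMap V Q t)⁻¹ := Submodule.mem_span_singleton.mpr ⟨t, h1⟩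
  let e := LinearEquiv.toSpanNonzeroSingleton V Q (algebraMap V Q t)⁻¹ (inv_ne_zero ht')
  refine ⟨hmem, LinearMap.toSpanSingleton V M y ∘ₗ e.symm.toLinearMap, ?_⟩
  have he : e.symm ⟨1, hmem⟩ = t := by
    rw [LinearEquiv.symm_apply_eq]
    exact Subtype.ext h1.symm
  simp [he, hy]

theorem one_le_heightIdeal (a : M) : (1 : Submodule V Q) ≤ heightIdeal Q a := by
  refine le_trans (le_of_eq ?_)
    (admitsMap_span_inv (Q := Q) one_ne_zero (one_smul V a)).le_heightIdeal
  rw [map_one, inv_one, Submodule.one_eq_span]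

/-- A linear map between submodules of the field of quotients that fixes `1` is an inclusion. -/
theorem linearMap_apply_eq_self {J : Submodule V Q} (h1 : (1 : Q) ∈ J) (φ : J →ₗ[V] Q)
    (hφ : φ ⟨1, h1⟩ = 1) (q : J) : φ q = q := by
  obtain ⟨⟨x, y⟩, hxy⟩ := IsLocalization.surj (nonZeroDivisors V) (q : Q)
  have hy : algebraMap V Q y ≠ 0 := by simp
  have h2 : (y : V) • q = x • (⟨1, h1⟩ : J) := by
    ext
    simp only [Submodule.coe_smul, Algebra.smul_def, mul_one]
    rw [mul_comm]
    exact hxy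
  have h3 := congrArg φ h2
  rw [map_smul, map_smul, hφ, Algebra.smul_def, Algebra.smul_def, mul_one, ← hxy] at h3
  exact mul_left_cancel₀ hy (h3.trans (mul_comm _ _))

/-- The height-ideal of an element that a map to the field of quotients sends to `1` is contained
in the range of that map. -/
theorem heightIdeal_le_range {a : M} (ψ : M →ₗ[V] Q) (ha : ψ a = 1) :
    heightIdeal (V := V) Q a ≤ LinearMap.range ψ := by
  refine sSup_le ?_
  rintro J ⟨h1, φ, rfl⟩ q hq
  exact ⟨φ ⟨q, hq⟩, linearMap_apply_eq_self h1 (ψ ∘ₗ φ) ha ⟨q, hq⟩⟩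

variable [ValuationRing V]

theorem inv_mem_heightIdeal_iff {t : V} (ht : t ≠ 0) {a : M} :
    (algebraMap V Q t)⁻¹ ∈ heightIdeal (V := V) Q a ↔ ∃ y : M, t • y = a := by
  have ht' : algebraMap V Q t ≠ 0 := by simpa using ht
  constructor
  · rw [mem_heightIdeal]
    rintro ⟨J, ⟨h1, φ, rfl⟩, hJ⟩
    refine ⟨φ ⟨_, hJ⟩, ?_⟩
    rw [← map_smul]
    congr 1
    ext
    simp only [Submodule.coe_smul, Algebra.smul_def]
    exact mul_inv_cancel₀ ht'
  · rintro ⟨y, hy⟩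
    exact (admitsMap_span_inv ht hy).le_heightIdeal (Submodule.mem_span_singleton_self _)

theorem mem_one_or_eq_inv (q : Q) :
    q ∈ (1 : Submodule V Q) ∨ ∃ t : V, t ≠ 0 ∧ q = (algebraMap V Q t)⁻¹ := by
  rcases ValuationRing.isInteger_or_isInteger V q with ⟨r, hr⟩ | ⟨r, hr⟩
  · exact Or.inl (Submodule.mem_one.mpr ⟨r, hr⟩)
  · by_cases h : r = 0
    · left
      rw [h, map_zero, eq_comm, inv_eq_zero] at hr
      rw [hr]
      exact Submodule.zero_mem _
    · exact Or.inr ⟨r, h, by rw [hr, inv_inv]⟩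

/-- If `a` has a largest divisor, then its height is a cyclic non-limit height. -/
theorem heightIdeal_eq_span_inv {t : V} (ht : t ≠ 0) {a y : M} (hy : t • y = a)
    (hmax : ∀ t' : V, ∀ y : M, t' • y = a → t' ∣ t) :
    heightIdeal (V := V) Q a = V ∙ (algebraMap V Q t)⁻¹ := by
  have ht' : algebraMap V Q t ≠ 0 := by simpa using ht
  refine le_antisymm (fun q hq => ?_) (admitsMap_span_inv ht hy).le_heightIdeal
  rw [Submodule.mem_span_singleton]
  rcases mem_one_or_eq_inv (V := V) q with h | ⟨t', ht0, rfl⟩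
  · obtain ⟨r, rfl⟩ := Submodule.mem_one.mp h
    exact ⟨r * t, by rw [Algebra.smul_def, map_mul, mul_assoc, mul_inv_cancel₀ ht', mul_one]⟩
  · obtain ⟨y', hy'⟩ := (inv_mem_heightIdeal_iff ht0).mp hq
    obtain ⟨c, rfl⟩ := hmax t' y' hy'
    have : algebraMap V Q t' ≠ 0 := by simpa using ht0
    have hc : algebraMap V Q c ≠ 0 := fun h => ht' (by rw [map_mul, h, mul_zero])
    refine ⟨c, ?_⟩
    rw [Algebra.smul_def, map_mul]
    field_simp

theorem isUniserial_fractionRing_submodule (J : Submodule V Q) : IsUniserial V J :=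
  fun A B => by
    rcases submodule_le_total (A.map J.subtype) (B.map J.subtype) with h | h
    · exact Or.inl ((Submodule.map_le_map_iff_of_injective J.subtype_injective _ _).mp h)
    · exact Or.inr ((Submodule.map_le_map_iff_of_injective J.subtype_injective _ _).mp h)

omit [IsDomain V] [ValuationRing V] in
theorem IsUniserial.of_surjective {f : M →ₗ[V] N} (h : IsUniserial V M)
    (hf : Function.Surjective f) : IsUniserial V N := by
  refine IsUniserial.of_smul_total fun x y => ?_
  obtain ⟨x, rfl⟩ := hf x
  obtain ⟨y, rfl⟩ := hf y
  rcases h.smul_total x y with ⟨v, rfl⟩ | ⟨v, rfl⟩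
  · exact Or.inl ⟨v, (map_smul f v x).symm⟩
  · exact Or.inr ⟨v, (map_smul f v y).symm⟩

omit [IsDomain V] [ValuationRing V] in
theorem IsUniserial.isPrincipal_of_fg (h : IsUniserial V M) {P : Submodule V M} (hP : P.FG) :
    P.IsPrincipal := by
  induction P, hP using Submodule.fg_induction with
  | singleton x => exact ⟨x, rfl⟩
  | sup A B hA hB =>
    rcases h A B with hAB | hAB
    · rwa [sup_eq_right.mpr hAB]
    · rwa [sup_eq_left.mpr hAB]

end Heights

/-! ### Heights in objects -/

section Objects

variable {V : Type u} [CommRing V] [IsDomain V] [ValuationRing V] {Q : Type w} [Field Q]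
  [Algebra V Q] [IsFractionRing V Q] {M : Type u} [AddCommGroup M] [Module V M]

/-- A uniserial submodule of an object that realizes the height of a nonzero element is countably
generated. -/
theorem IsObject.countably_generated_of_heightIdeal_eq (hM : IsObject V M) {a : M} (ha : a ≠ 0)
    {W : Submodule V M} (haW : a ∈ W) (hW : IsUniserial V W)
    (hH : heightIdeal (V := V) Q (⟨a, haW⟩ : W) = heightIdeal Q a) :
    ∃ s : Set M, s.Countable ∧ Submodule.span V s = W := by
  obtain ⟨B, C, κ, π, hκ, hπ, hex⟩ := hM.exists_free_presentation
  rcases hW.countably_generated_or_le_map_supported hκ hπ hex with h | ⟨X, hX⟩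
  · exact h
  -- Equality of heights makes `t` divide `a` inside `W`, say `t • w = a`. If `w = v • x` with `x ∈
  -- W`, then `t * v` also divides `a`, so maximality of `t` makes `v` a unit; thus `w` generates
  -- `W`.
  obtain ⟨t, ⟨y, hyX, hy⟩, hmax⟩ := exists_largest_divisor hκ hex X ha (hX haW)
  have ht : t ≠ 0 := fun h => ha (by rw [← hy, h, zero_smul])
  obtain ⟨w, hw⟩ := (inv_mem_heightIdeal_iff ht).mp
    (hH.symm ▸ (inv_mem_heightIdeal_iff (Q := Q) ht).mpr ⟨y, hy⟩)
  have hwa : t • (w : M) = a := congrArg Subtype.val hw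
  refine ⟨{(w : M)}, Set.countable_singleton _, le_antisymm (by simp) fun x hx => ?_⟩
  rw [Submodule.mem_span_singleton]
  rcases hW.smul_total_of_mem w.2 hx with h | ⟨v, hv⟩
  · exact h
  · have hdvd := hmax (t * v) x (hX hx) (by rw [mul_smul, hv, hwa])
    have hv1 : v ∣ 1 := (mul_dvd_mul_iff_left ht).mp (by simpa using hdvd)
    obtain ⟨u, hu⟩ := hv1
    exact ⟨u, by rw [← hv, smul_smul, mul_comm, ← hu, one_smul]⟩

/-- A finitely generated object is one of its own finite parts, so `a` has a largest divisor in all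
of `M`. -/
theorem IsObject.isNonLimitHeight_of_finite (hM : IsObject V M) [hfin : Module.Finite V M] {a : M}
    (ha : a ≠ 0) : IsNonLimitHeight V Q a := by
  classical
  obtain ⟨B, C, κ, π, hκ, hπ, hex⟩ := hM.exists_free_presentation
  obtain ⟨X, hX⟩ : ∃ X : Finset B, ⊤ ≤ (Finsupp.supported V V (X : Set B)).map π := by
    obtain ⟨S, hS⟩ := hfin.fg_top
    choose X hX using exists_mem_map_supported (V := V) hπ
    refine ⟨S.biUnion X, ?_⟩
    rw [← hS, Submodule.span_le]
    intro m hm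
    exact Submodule.map_mono (Finsupp.supported_mono
      (Finset.coe_subset.mpr (Finset.subset_biUnion_of_mem X hm))) (hX m)
  obtain ⟨t, ⟨y, -, hy⟩, hmax⟩ := exists_largest_divisor hκ hex X ha (hX Submodule.mem_top)
  have ht : t ≠ 0 := fun h => ha (by rw [← hy, h, zero_smul])
  have hmax' : ∀ t' : V, ∀ y : M, t' • y = a → t' ∣ t :=
    fun t' y h => hmax t' y (hX Submodule.mem_top) h
  unfold IsNonLimitHeight
  rw [heightIdeal_eq_span_inv ht hy hmax']
  exact admitsMap_span_inv ht hy

theorem IsObject.gen_height_le_aleph0 (hM : IsObject V M) {a : M} (ha : a ≠ 0)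
    (hlim : IsNonLimitHeight V Q a) : gen V (Height (V := V) Q a) ≤ Cardinal.aleph0 := by
  obtain ⟨h1, φ, hφ⟩ := hlim
  have haW : a ∈ LinearMap.range φ := ⟨_, hφ⟩
  have hW : IsUniserial V (LinearMap.range φ) :=
    (isUniserial_fractionRing_submodule _).of_surjective φ.surjective_rangeRestrict
  have hH : heightIdeal (V := V) Q (⟨a, haW⟩ : LinearMap.range φ) = heightIdeal Q a :=
    le_antisymm (heightIdeal_le_map _ (LinearMap.range φ).subtype)
      (AdmitsMap.le_heightIdeal ⟨h1, φ.rangeRestrict, Subtype.ext hφ⟩)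
  obtain ⟨s, hs, hsW⟩ := hM.countably_generated_of_heightIdeal_eq ha haW hW hH
  have hsr : ∀ x : s, ∃ q, φ q = x := fun x => by
    have : (x : M) ∈ LinearMap.range φ := hsW ▸ Submodule.subset_span x.2
    exact this
  choose q hq using hsr
  let mk := ((1 : Submodule V Q).submoduleOf (heightIdeal (V := V) Q a)).mkQ
  have : Countable s := hs
  have htop : (⊤ : Submodule V (Height (V := V) Q a)) =
      Submodule.span V (Set.range fun x : s => mk (q x)) := by
    refine (eq_top_iff.mpr fun z _ => ?_).symm
    obtain ⟨z, rfl⟩ := Submodule.mkQ_surjective _ z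
    have hz : φ z ∈ (Submodule.span V (Set.range q)).map φ := by
      rw [Submodule.map_span, ← Set.range_comp]
      have : Set.range (φ ∘ q) = s := by
        rw [show φ ∘ q = Subtype.val from funext hq, Subtype.range_coe]
      rw [this, hsW]
      exact LinearMap.mem_range_self φ z
    obtain ⟨t, ht, htz⟩ := hz
    -- An element of `ker φ` outside `V` would have `1` as a multiple, giving `a = φ 1 = 0`. So
    -- generators of the image of `φ` lift to generators modulo `V`.
    have hker : z - t ∈ (1 : Submodule V Q).submoduleOf (heightIdeal (V := V) Q a) := by
      rw [Submodule.submoduleOf, Submodule.mem_comap]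
      by_contra hnot
      rcases (isUniserial_fractionRing_submodule (heightIdeal (V := V) Q a)).smul_total
        (z - t) ⟨1, h1⟩ with ⟨v, hv⟩ | ⟨v, hv⟩
      · apply ha
        rw [← hφ, ← hv, map_smul, map_sub, htz, sub_self, smul_zero]
      · apply hnot
        rw [← hv]
        exact Submodule.smul_mem _ v (Submodule.mem_one.mpr ⟨1, map_one _⟩)
    have hzt : mk z = mk t := (Submodule.Quotient.eq _).mpr hker
    change mk z ∈ _
    rw [hzt]
    have := Submodule.mem_map_of_mem (f := mk) ht
    rwa [Submodule.map_span, ← Set.range_comp] at this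
  unfold gen
  rw [htop]
  refine (Submodule.spanRank_span_le_card _).trans ?_
  rw [Cardinal.le_aleph0_iff_set_countable]
  exact Set.countable_range _

theorem IsObject.isStandardLimitHeight (hM : IsObject V M) {a : M} (ha : a ≠ 0)
    (hlim : IsLimitHeight V Q a) : IsStandardLimitHeight V Q a := by
  refine ⟨hlim, ⟨1, heightIdeal Q a, lt_of_le_of_ne (one_le_heightIdeal a) fun h => hlim ?_,
    ⟨LinearEquiv.refl V _⟩⟩, fun W haW hW hH => ?_⟩
  · have := admitsMap_span_inv (Q := Q) one_ne_zero (one_smul V a)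
    rwa [map_one, inv_one, ← Submodule.one_eq_span, h] at this
  · obtain ⟨s, hs, hsW⟩ := hM.countably_generated_of_heightIdeal_eq ha haW hW hH
    have hsub : s ⊆ W := hsW ▸ Submodule.subset_span
    refine hW.isStandardUniserial (s := Subtype.val ⁻¹' s)
      (hs.preimage Subtype.val_injective) ?_ (a := ⟨a, haW⟩) (fun h => ha (congrArg Subtype.val h))
    apply Submodule.map_injective_of_injective W.subtype_injective
    rw [Submodule.map_span, Submodule.map_top, Submodule.range_subtype]
    change Submodule.span V (Subtype.val '' (Subtype.val ⁻¹' s)) = W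
    rw [Set.image_preimage_eq_of_subset (fun x hx => ⟨⟨x, hsub hx⟩, rfl⟩), hsW]

theorem IsObject.height_trichotomy (hM : IsObject V M) {a : M} (ha : a ≠ 0) :
    IsCyclicHeight V Q a ∨ IsCountablyGeneratedNonLimitHeight V Q a ∨
      IsStandardLimitHeight V Q a := by
  by_cases hlim : IsNonLimitHeight V Q a
  · rcases (hM.gen_height_le_aleph0 ha hlim).lt_or_eq with h | h
    · refine Or.inl ⟨hlim, ?_⟩
      exact ((isUniserial_fractionRing_submodule _).of_surjective
        (Submodule.mkQ_surjective _)).isPrincipal_of_fg (Submodule.spanRank_finite_iff_fg.mp h)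
    · exact Or.inr (Or.inl ⟨hlim, h⟩)
  · exact Or.inr (Or.inr (hM.isStandardLimitHeight ha hlim))

end Objects

/-! ### Realizing non-limit heights -/

/-- The module `J` with the element `1` works: a map between submodules of `Q` fixing `1` is an
inclusion, so nothing larger than `J` maps to `J`. -/
theorem exists_object_isNonLimitHeight {V Q : Type u} [CommRing V] [IsDomain V] [ValuationRing V]
    [Field Q] [Algebra V Q] [IsFractionRing V Q] (J : Submodule V Q) (h1 : (1 : Submodule V Q) ≤ J)
    (hJ : J.spanRank ≤ Cardinal.aleph0) :
    ∃ (M : Type u) (_ : AddCommGroup M) (_ : Module V M) (a : M), IsObject V M ∧ a ≠ 0 ∧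
      heightIdeal (V := V) Q a = J ∧ IsNonLimitHeight V Q a := by
  have h1J : (1 : Q) ∈ J := h1 (Submodule.mem_one.mpr ⟨1, map_one _⟩)
  have hmap : AdmitsMap J (⟨1, h1J⟩ : J) := ⟨h1J, LinearMap.id, rfl⟩
  have hH : heightIdeal (V := V) Q (⟨1, h1J⟩ : J) = J := by
    refine le_antisymm ?_ hmap.le_heightIdeal
    simpa using heightIdeal_le_range (a := (⟨1, h1J⟩ : J)) J.subtype rfl
  have ha : (⟨1, h1J⟩ : J) ≠ 0 := fun h => one_ne_zero (congrArg Subtype.val h)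
  obtain ⟨s, hs, hsJ⟩ := (⊤ : Submodule V J).exists_span_set_card_eq_spanRank
  rw [Submodule.spanRank_top] at hs
  refine ⟨J, inferInstance, inferInstance, ⟨1, h1J⟩,
    (isUniserial_fractionRing_submodule J).isObject ?_ hsJ ha, ha, hH, ?_⟩
  · rw [← Cardinal.le_aleph0_iff_set_countable, hs]
    exact hJ
  · unfold IsNonLimitHeight
    rwa [hH]

/-! ### Realizing limit heights by an amalgam -/

namespace Amalgam

variable {V Q : Type u} [CommRing V] [Field Q] [Algebra V Q] (J : Submodule V Q)

/-- The nonzero elements of `V` with inverse in `J`. -/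
abbrev Index : Type u := {r : V // r ≠ 0 ∧ (algebraMap V Q r)⁻¹ ∈ J}

/-- The relations identifying `r x_r` with the distinguished element, for all `r`. -/
noncomputable def relations : (Index J →₀ V) →ₗ[V] V × (Index J →₀ V) :=
  (-Finsupp.linearCombination V fun _ => (1 : V)).prod
    (Finsupp.linearCombination V fun r => Finsupp.single r r.1)

/-- The amalgam of the modules `V r⁻¹` contained in `J` along their common submodule `V`. -/
abbrev Carrier : Type u := (V × (Index J →₀ V)) ⧸ LinearMap.range (relations J)

/-- The distinguished element of the amalgam. -/
noncomputable def base : Carrier J := (LinearMap.range (relations J)).mkQ (1, 0)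

theorem relations_single (r : Index J) (v : V) :
    relations J (Finsupp.single r v) = (-v, Finsupp.single r (v * r.1)) := by
  simp [relations]

/-- The second component is diagonal with the nonzero entries `r`. -/
theorem relations_injective [IsDomain V] : Function.Injective (relations J) := by
  rw [injective_iff_map_eq_zero]
  intro b hb
  have h2 : ∀ (b : Index J →₀ V) (r : Index J), (relations J b).2 r = b r * r.1 := by
    intro b r
    induction b using Finsupp.induction_linear with
    | zero => simp
    | add f g hf hg => rw [map_add, Prod.snd_add, Finsupp.add_apply, hf, hg, Finsupp.add_apply,
        add_mul]
    | single k v =>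
      rw [relations_single]
      by_cases h : k = r
      · subst h; simp
      · simp [h]
  ext r
  have := h2 b r
  rw [hb] at this
  exact (mul_eq_zero.mp this.symm).resolve_right r.2.1

theorem isObject [IsDomain V] : IsObject V (Carrier J) :=
  isObject_of_exact (relations J) (LinearMap.range (relations J)).mkQ (relations_injective J)
    (Submodule.mkQ_surjective _) (LinearMap.exact_map_mkQ_range _)

theorem smul_mk_single (r : Index J) :
    r.1 • (LinearMap.range (relations J)).mkQ (0, Finsupp.single r 1) = base J := by
  rw [base, ← map_smul]
  refine (Submodule.Quotient.eq _).mpr ⟨Finsupp.single r 1, ?_⟩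
  simp [relations_single]

/-- A map on the amalgam from compatible images of the generators. -/
noncomputable def desc {N : Type*} [AddCommGroup N] [Module V N] (a : N) (x : Index J → N)
    (hx : ∀ r, r.1 • x r = a) : Carrier J →ₗ[V] N :=
  (LinearMap.range (relations J)).liftQ
    ((LinearMap.toSpanSingleton V N a).coprod (Finsupp.linearCombination V x)) (by
      rintro _ ⟨b, rfl⟩
      rw [LinearMap.mem_ker]
      induction b using Finsupp.induction_linear with
      | zero => simp
      | add f g hf hg => rw [map_add, map_add, hf, hg, add_zero]
      | single r v =>
        rw [relations_single, LinearMap.coprod_apply, LinearMap.toSpanSingleton_apply,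
          Finsupp.linearCombination_single, mul_smul, hx, neg_smul, neg_add_cancel])

theorem desc_mk {N : Type*} [AddCommGroup N] [Module V N] (a : N) (x : Index J → N)
    (hx : ∀ r, r.1 • x r = a) (α : V) (β : Index J →₀ V) :
    desc J a x hx ((LinearMap.range (relations J)).mkQ (α, β)) =
      α • a + Finsupp.linearCombination V x β :=
  rfl

variable [IsDomain V] [IsFractionRing V Q]

omit [IsDomain V] in
theorem smul_inv_eq_one {r : V} (hr : r ≠ 0) : r • (algebraMap V Q r)⁻¹ = 1 := by
  rw [Algebra.smul_def, mul_inv_cancel₀ (by simpa using hr)]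

/-- The canonical map of the amalgam onto `J`. -/
noncomputable def toField : Carrier J →ₗ[V] Q :=
  desc J 1 (fun r => (algebraMap V Q r.1)⁻¹) fun r => smul_inv_eq_one r.2.1

omit [IsDomain V] in
theorem toField_base : toField J (base J) = 1 := by
  rw [toField, base, desc_mk]; simp

omit [IsDomain V] in
theorem range_toField_le (h1 : (1 : Q) ∈ J) : LinearMap.range (toField J) ≤ J := by
  rintro _ ⟨m, rfl⟩
  obtain ⟨⟨α, β⟩, rfl⟩ := Submodule.mkQ_surjective _ m
  rw [toField, desc_mk]
  exact J.add_mem (J.smul_mem _ h1) (J.sum_mem fun r _ => J.smul_mem _ r.2.2)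

theorem heightIdeal_base [ValuationRing V] (h1 : (1 : Submodule V Q) ≤ J) :
    heightIdeal (V := V) Q (base J) = J := by
  refine le_antisymm ((heightIdeal_le_range (toField J) (toField_base J)).trans
    (range_toField_le J (h1 (Submodule.mem_one.mpr ⟨1, map_one _⟩)))) fun q hq => ?_
  rcases mem_one_or_eq_inv (V := V) q with h | ⟨t, ht, rfl⟩
  · exact one_le_heightIdeal _ h
  · exact (inv_mem_heightIdeal_iff ht).mpr ⟨_, smul_mk_single J ⟨t, ht, hq⟩⟩

variable [ValuationRing V]

variable {J} in
/-- A non-principal submodule of the field of quotients contains inverses of proper multiples. -/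
theorem exists_mul_index (hJ : ¬ J.IsPrincipal) (r : Index J) :
    ∃ s : V, ¬ IsUnit s ∧ r.1 * s ≠ 0 ∧ (algebraMap V Q (r.1 * s))⁻¹ ∈ J := by
  have hle : (V ∙ (algebraMap V Q r.1)⁻¹) ≤ J := by simpa using r.2.2
  obtain ⟨q, hqJ, hq⟩ : ∃ q ∈ J, q ∉ V ∙ (algebraMap V Q r.1)⁻¹ := by
    by_contra! hcon
    exact hJ ⟨_, le_antisymm hcon hle⟩
  rcases mem_one_or_eq_inv (V := V) q with h | ⟨t, ht, rfl⟩
  · refine absurd ?_ hq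
    obtain ⟨v, rfl⟩ := Submodule.mem_one.mp h
    refine Submodule.mem_span_singleton.mpr ⟨v * r.1, ?_⟩
    rw [mul_smul, smul_inv_eq_one r.2.1, Algebra.smul_def, mul_one]
  · have hnot : ¬ t ∣ r.1 := by
      rintro ⟨c, hc⟩
      apply hq
      refine Submodule.mem_span_singleton.mpr ⟨c, ?_⟩
      have h0 := r.2.1
      rw [hc] at h0 ⊢
      have hc0 : algebraMap V Q c ≠ 0 := by simpa using right_ne_zero_of_mul h0
      have ht0 : algebraMap V Q t ≠ 0 := by simpa using ht
      rw [Algebra.smul_def, map_mul]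
      field_simp
    obtain ⟨s, rfl⟩ := (ValuationRing.dvd_total t r.1).resolve_left hnot
    exact ⟨s, fun hs => hnot ((hs.mul_right_dvd).mpr dvd_rfl), ht, hqJ⟩

omit [IsFractionRing V Q] in
variable {J} in
theorem exists_index_forall_dvd (h1 : (1 : Q) ∈ J) (S : Finset (Index J)) :
    ∃ r : Index J, ∀ l ∈ S, l.1 ∣ r.1 := by
  classical
  induction S using Finset.induction_on with
  | empty => exact ⟨⟨1, one_ne_zero, by simpa using h1⟩, by simp⟩
  | insert l S _ ih =>
    obtain ⟨r, hr⟩ := ih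
    rcases ValuationRing.dvd_total l.1 r.1 with h | h
    · exact ⟨r, (Finset.forall_mem_insert _ _ _).mpr ⟨h, hr⟩⟩
    · exact ⟨l, (Finset.forall_mem_insert _ _ _).mpr ⟨dvd_rfl, fun k hk => (hr k hk).trans h⟩⟩

/-- Fix a non-unit `r` with `r⁻¹ ∈ J`. The element `φ (r⁻¹)` involves finitely many generators, all
with index dividing some `r₀`; comparing it with `φ ((r₀ s)⁻¹)` for a non-unit `s` yields `s γ + r δ
= 1`. -/
theorem not_admitsMap_base (hJ : ¬ J.IsPrincipal) :
    ¬ AdmitsMap J (base J) := by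
  classical
  rintro ⟨h1J, φ, hφ⟩
  obtain ⟨r, hr, hr0, hrJ⟩ := exists_mul_index hJ ⟨1, one_ne_zero, by simpa using h1J⟩
  simp only [one_mul] at hr0 hrJ
  obtain ⟨⟨α, β⟩, hαβ⟩ := Submodule.mkQ_surjective _ (φ ⟨_, hrJ⟩)
  obtain ⟨r₀, hr₀⟩ := exists_index_forall_dvd h1J (insert ⟨r, hr0, hrJ⟩ β.support)
  obtain ⟨s, hs, hs0, hsJ⟩ := exists_mul_index hJ r₀
  obtain ⟨c, hc⟩ := hr₀ _ (Finset.mem_insert_self _ _)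
  simp only at hc
  obtain ⟨⟨α', β'⟩, hαβ'⟩ := Submodule.mkQ_surjective _ (φ ⟨_, hsJ⟩)
  have hQ : ∀ v : V, v ≠ 0 → algebraMap V Q v ≠ 0 := fun v hv => by simpa using hv
  -- the part of an element of the amalgam that lies beyond `r₀`
  let e : Index J → Q := fun l => if l.1 ∣ r₀.1 then 0 else (algebraMap V Q l.1)⁻¹
  let e' : Index J → Q := fun l => if l.1 ∣ r₀.1 then (algebraMap V Q l.1)⁻¹ else 0
  -- Erasing the generators with index dividing `r₀` respects the relations only once the base
  -- element goes to `0`, which is why values are taken modulo `V`.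
  let θ : Carrier J →ₗ[V] Q ⧸ (1 : Submodule V Q) :=
    desc J 0 (fun l => (1 : Submodule V Q).mkQ (e l)) fun l => by
      by_cases hl : l.1 ∣ r₀.1
      · simp [e, hl]
      · rw [← map_smul]
        simp only [e, hl, if_false]
        rw [smul_inv_eq_one l.2.1]
        exact (Submodule.Quotient.mk_eq_zero _).mpr (Submodule.mem_one.mpr ⟨1, map_one _⟩)
  have hθ : ∀ α β, θ ((LinearMap.range (relations J)).mkQ (α, β)) =
      (1 : Submodule V Q).mkQ (Finsupp.linearCombination V e β) := by
    intro α β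
    rw [desc_mk, smul_zero, zero_add, ← LinearMap.comp_apply,
      ← Finsupp.linearCombination_linear_comp]
    rfl
  have hsmul : (c * s) • φ ⟨_, hsJ⟩ = φ ⟨_, hrJ⟩ := by
    rw [← map_smul]
    congr 1
    ext
    have h2 := hs0
    rw [hc] at h2
    simp only [Submodule.coe_smul, Algebra.smul_def, hc, map_mul]
    have hr' := hQ r hr0
    have hc' := hQ c (right_ne_zero_of_mul (left_ne_zero_of_mul h2))
    have hs' := hQ s (right_ne_zero_of_mul h2)
    field_simp
  have hθr : θ (φ ⟨_, hrJ⟩) = 0 := by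
    rw [← hαβ, hθ, Finsupp.linearCombination_apply, Finsupp.sum, Finset.sum_eq_zero, map_zero]
    intro l hl
    simp [e, hr₀ l (Finset.mem_insert_of_mem hl)]
  -- `θ` kills `φ (r⁻¹) = c s φ ((r₀ s)⁻¹)`, so `c s` times the part of `φ ((r₀ s)⁻¹)` beyond `r₀`
  -- is integral.
  obtain ⟨δ, hδ⟩ : ∃ δ : V, algebraMap V Q δ =
      (c * s) • Finsupp.linearCombination V e β' := by
    rw [← hsmul, map_smul, ← hαβ', hθ, ← map_smul] at hθr
    exact Submodule.mem_one.mp ((Submodule.Quotient.mk_eq_zero _).mp hθr)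
  have hr₀0 := hQ _ r₀.2.1
  obtain ⟨γ, hγ⟩ : ∃ γ : V, γ • (algebraMap V Q r₀.1)⁻¹ =
      α' • (1 : Q) + Finsupp.linearCombination V e' β' := by
    rw [← Submodule.mem_span_singleton]
    refine Submodule.add_mem _ (Submodule.smul_mem _ _ ?_)
      (Submodule.sum_mem _ fun l _ => Submodule.smul_mem _ _ ?_)
    · exact Submodule.mem_span_singleton.mpr ⟨r₀.1, smul_inv_eq_one r₀.2.1⟩
    · by_cases hl : l.1 ∣ r₀.1
      · obtain ⟨d, hd⟩ := hl
        refine Submodule.mem_span_singleton.mpr ⟨d, ?_⟩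
        have hd0 : d ≠ 0 := fun h => r₀.2.1 (by rw [hd, h, mul_zero])
        have hl' := hQ _ l.2.1
        have hd' := hQ _ hd0
        simp only [e', show l.1 ∣ r₀.1 from ⟨d, hd⟩, if_true, Algebra.smul_def]
        rw [hd, map_mul]
        field_simp
      · simp [e', hl]
  have hψ : toField J (φ ⟨_, hsJ⟩) = (algebraMap V Q (r₀.1 * s))⁻¹ :=
    linearMap_apply_eq_self h1J (toField J ∘ₗ φ) (by
      rw [LinearMap.comp_apply, hφ, toField_base]) ⟨_, hsJ⟩
  have hsum : Finsupp.linearCombination V (fun l : Index J => (algebraMap V Q l.1)⁻¹) β' =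
      Finsupp.linearCombination V e' β' + Finsupp.linearCombination V e β' := by
    simp only [Finsupp.linearCombination_apply]
    rw [← Finsupp.sum_add]
    refine Finsupp.sum_congr fun l _ => ?_
    by_cases hl : l.1 ∣ r₀.1 <;> simp [e, e', hl]
  rw [← hαβ', toField, desc_mk, hsum, ← add_assoc, ← hγ] at hψ
  -- The image `(r₀ s)⁻¹` in `Q` is `γ r₀⁻¹` plus the part beyond `r₀`; multiply by `r₀ s = r c s`.
  have hfin : s * γ + r * δ = 1 := by
    apply IsFractionRing.injective V Q
    have hs' := hQ _ hs0
    rw [map_mul] at hs'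
    rw [map_mul, Algebra.smul_def] at hψ
    rw [Algebra.smul_def] at hδ
    have hc' := congrArg (algebraMap V Q) hc
    rw [map_mul] at hc' hδ
    rw [map_add, map_mul, map_mul, map_one, hδ]
    have h3 := congrArg (fun z => (algebraMap V Q r₀.1 * algebraMap V Q s) * z) hψ
    simp only [mul_add, mul_inv_cancel₀ hs'] at h3
    rw [← h3]
    have h4 : algebraMap V Q r₀.1 * algebraMap V Q s *
        (algebraMap V Q γ * (algebraMap V Q r₀.1)⁻¹) = algebraMap V Q s * algebraMap V Q γ := by
      field_simp
    rw [h4, hc']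
    ring
  rcases IsLocalRing.isUnit_or_isUnit_of_add_one hfin with h | h
  · exact hs (isUnit_of_mul_isUnit_left h)
  · exact hr (isUnit_of_mul_isUnit_left h)

end Amalgam

theorem exists_object_isStandardLimitHeight {V Q : Type u} [CommRing V] [IsDomain V]
    [ValuationRing V] [Field Q] [Algebra V Q] [IsFractionRing V Q] (J : Submodule V Q)
    (h1 : (1 : Submodule V Q) ≤ J) (hJ : ¬ J.IsPrincipal) :
    ∃ (M : Type u) (_ : AddCommGroup M) (_ : Module V M) (a : M), IsObject V M ∧ a ≠ 0 ∧
      heightIdeal (V := V) Q a = J ∧ IsStandardLimitHeight V Q a := by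
  have ha : Amalgam.base J ≠ 0 := fun h => by
    have := Amalgam.toField_base J
    rw [h, map_zero] at this
    exact zero_ne_one this
  have hH := Amalgam.heightIdeal_base J h1
  refine ⟨Amalgam.Carrier J, inferInstance, inferInstance, Amalgam.base J, Amalgam.isObject J, ha,
    hH, (Amalgam.isObject J).isStandardLimitHeight ha ?_⟩
  unfold IsLimitHeight IsNonLimitHeight
  rw [hH]
  exact Amalgam.not_admitsMap_base J hJ

theorem mainTheorem9 {V Q : Type u} [CommRing V] [IsDomain V] [ValuationRing V]
    [Field Q] [Algebra V Q] [IsFractionRing V Q] :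
    (∀ (M : Type u) [AddCommGroup M] [Module V M], IsObject V M → ∀ a : M, a ≠ 0 →
      (IsCyclicHeight V Q a ∨ IsCountablyGeneratedNonLimitHeight V Q a ∨
        IsStandardLimitHeight V Q a) ∧
      ¬ IsUncountablyGeneratedNonLimitHeight V Q a ∧
      (Module.Finite V M → ¬ IsLimitHeight V Q a)) ∧
    (∀ J : Submodule V Q, (1 : Submodule V Q) ≤ J → J.spanRank ≤ Cardinal.aleph0 →
      ∃ (M : Type u) (_ : AddCommGroup M) (_ : Module V M) (a : M), IsObject V M ∧ a ≠ 0 ∧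
        heightIdeal (V := V) Q a = J ∧ IsNonLimitHeight V Q a) ∧
    (∀ J : Submodule V Q, (1 : Submodule V Q) ≤ J → ¬ J.IsPrincipal →
      ∃ (M : Type u) (_ : AddCommGroup M) (_ : Module V M) (a : M), IsObject V M ∧ a ≠ 0 ∧
        heightIdeal (V := V) Q a = J ∧ IsStandardLimitHeight V Q a) := by
  refine ⟨fun M _ _ hM a ha => ⟨hM.height_trichotomy ha, ?_, ?_⟩,
    exists_object_isNonLimitHeight, exists_object_isStandardLimitHeight⟩
  · rintro ⟨hlim, hgen⟩
    exact hgen.not_ge (hM.gen_height_le_aleph0 ha hlim)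
  · exact fun _ hlim => hlim (hM.isNonLimitHeight_of_finite ha)
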